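/- Let $M$ be a complex manifold of dimension $n$, $\pi:E\to M$ a holomorphic vector bundle of rank $m$, and $(E,[\cdot,\cdot]_E,\rho)$ a holomorphic Lie algebroid: $\rho:E\to T'M$ is a holomorphic bundle morphism, and $[\cdot,\cdot]_E$ is a Lie bracket on the sheaf of holomorphic sections of $E$ with $[s,ft]_E=f[s,t]_E+\rho(s)(f)\,t$ for holomorphic $f$. The complexified prolongation $\mathcal T_{\mathbb C}E$ has as fibre at $u\in E$ the space of all $(a,v)\in (E_{\mathbb C})_{\pi(u)}\times (T_{\mathbb C}E)_u$ with $\rho_{\mathbb C}(a)=\pi_{*,\mathbb C}(v)$, where $\rho_{\mathbb C}$, $\pi_{*,\mathbb C}$ are the complex linear extensions. Its anchor is $\rho_{\mathcal T}(a,v)=v$. Its bracket $[\cdot,\cdot]_{\mathcal T}$ has as second component the Lie bracket of complex vector fields on $E$; if $b_\gamma$ is a holomorphic local frame of $E$, $b_{\bar\gamma}=\overline{b_\gamma}$, and (pulling back to $E$) $\sigma=(a^\gamma b_\gamma+a^{\bar\gamma}b_{\bar\gamma},X)$, $\tau=(c^\gamma b_\gamma+c^{\bar\gamma}b_{\bar\gamma},Y)$,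 then the first component of $[\sigma,\tau]_{\mathcal T}$ is $$a^\gamma c^\varepsilon[b_\gamma,b_\varepsilon]_E+(Xc^\gamma-Ya^\gamma)b_\gamma+a^{\bar\gamma}c^{\bar\varepsilon}\,\overline{[b_\gamma,b_\varepsilon]_E}+(Xc^{\bar\gamma}-Ya^{\bar\gamma})b_{\bar\gamma}.$$ Let $(z^k)$ be holomorphic coordinates on an open set $U\subset M$ and $(e_\alpha)$ a holomorphic frame of $E$ over $U$, giving coordinates $(z^k,u^\alpha)$ on $\pi^{-1}(U)$, and write $\partial_k=\partial/\partial z^k$, $\dot\partial_\alpha=\partial/\partial u^\alpha$, $\dot\partial_{\bar\alpha}=\partial/\partial\bar u^\alpha$. Put $\rho(e_\alpha)=\rho^k_\alpha\,\partial/\partial z^k$ and $[e_\alpha,e_\beta]_E=\mathcal C^\gamma_{\alpha\beta}e_\gamma$ (the $\rho^k_\alpha$, $\mathcal C^\gamma_{\alpha\beta}$ are regarded as functions on $\pi^{-1}(U)$ through $\pi$). Let $W\subset\pi^{-1}(U)$ be open, and let $N_\alpha^\beta:W\to\mathbb C$ be smooth functions (the coefficients of a complex nonlinear connection on the prolongation).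 On $W$ set $$\mathcal Z_\alpha=(e_\alpha,\rho^k_\alpha\partial_k),\quad \mathcal V_\alpha=(0,\dot\partial_\alpha),\quad \mathcal X_\alpha=\mathcal Z_\alpha-N_\alpha^\beta\mathcal V_\beta,\quad \delta_\alpha=\rho^k_\alpha\partial_k-N_\alpha^\beta\dot\partial_\beta,$$ and let $\mathcal X_{\bar\alpha},\mathcal V_{\bar\alpha},\delta_{\bar\alpha},N^{\bar\beta}_{\bar\alpha}$ denote the conjugates. Then $\mathcal X_\alpha,\mathcal V_\alpha,\mathcal X_{\bar\alpha},\mathcal V_{\bar\alpha}$ are sections of $\mathcal T_{\mathbb C}E$ over $W$; if $N_\alpha^\beta=\rho^k_\alpha N_k^\beta$ for functions $N_k^\beta$ on $W$, then $\delta_\alpha=\rho^k_\alpha\delta_k$ with $\delta_k=\partial_k-N_k^\beta\dot\partial_\beta$; and on $W$ \begin{align*} [\mathcal X_\alpha,\mathcal X_\beta]_{\mathcal T}&=\mathcal C^\gamma_{\alpha\beta}\mathcal X_\gamma+\mathcal R^\gamma_{\alpha\beta}\mathcal V_\gamma, \qquad \mathcal R^\gamma_{\alpha\beta}=\mathcal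 C^\varepsilon_{\alpha\beta}N^\gamma_\varepsilon-\delta_\alpha N^\gamma_\beta+\delta_\beta N^\gamma_\alpha,\\ [\mathcal X_\alpha,\mathcal X_{\bar\beta}]_{\mathcal T}&=(\delta_{\bar\beta}N^\gamma_\alpha)\mathcal V_\gamma-(\delta_\alpha N^{\bar\gamma}_{\bar\beta})\mathcal V_{\bar\gamma},\\ [\mathcal X_\alpha,\mathcal V_\beta]_{\mathcal T}&=(\dot\partial_\beta N^\gamma_\alpha)\mathcal V_\gamma,\qquad [\mathcal X_\alpha,\mathcal V_{\bar\beta}]_{\mathcal T}=(\dot\partial_{\bar\beta}N^\gamma_\alpha)\mathcal V_\gamma,\\ [\mathcal V_\alpha,\mathcal V_\beta]_{\mathcal T}&=0,\qquad [\mathcal V_\alpha,\mathcal V_{\bar\beta}]_{\mathcal T}=0, \end{align*} together with the conjugate formulas \begin{align*} [\mathcal X_{\bar\alpha},\mathcal X_{\bar\beta}]_{\mathcal T}&=\overline{\mathcal C^\gamma_{\alpha\beta}}\,\mathcal X_{\bar\gamma}+\overline{\mathcal R^\gamma_{\alpha\beta}}\,\mathcal V_{\bar\gamma},& [\mathcal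 X_{\bar\alpha},\mathcal V_{\bar\beta}]_{\mathcal T}&=(\dot\partial_{\bar\beta}N^{\bar\gamma}_{\bar\alpha})\mathcal V_{\bar\gamma},\\ [\mathcal X_{\bar\alpha},\mathcal V_{\beta}]_{\mathcal T}&=(\dot\partial_{\beta}N^{\bar\gamma}_{\bar\alpha})\mathcal V_{\bar\gamma},& [\mathcal V_{\bar\alpha},\mathcal V_{\bar\beta}]_{\mathcal T}&=0. \end{align*} -/

import Mathlib

open scoped Manifold ContDiff Bundle TensorProduct
open Bundle

noncomputable section

namespace HolAlg

/-! ### Complexification of real vector spaces -/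

section Complexification

/-- The complexification `V_ℂ = ℂ ⊗ V` of a real vector space `V`. -/
abbrev Cx (V : Type*) [AddCommGroup V] [Module ℝ V] : Type _ := ℂ ⊗[ℝ] V

variable {V : Type*} [AddCommGroup V] [Module ℝ V]

/-- Real part: `re (x + i y) = x`. -/
def Cx.re : Cx V →ₗ[ℝ] V :=
  (TensorProduct.lid ℝ V).toLinearMap ∘ₗ LinearMap.rTensor V Complex.reLm

/-- Imaginary part: `im (x + i y) = y`. -/
def Cx.im : Cx V →ₗ[ℝ] V :=
  (TensorProduct.lid ℝ V).toLinearMap ∘ₗ LinearMap.rTensor V Complex.imLm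

/-- The element `x + i y`. -/
def Cx.mk (x y : V) : Cx V := (1 : ℂ) ⊗ₜ[ℝ] x + Complex.I ⊗ₜ[ℝ] y

/-- Complex conjugation: `conj (x + i y) = x - i y`. -/
def Cx.conj : Cx V →ₗ[ℝ] Cx V :=
  LinearMap.rTensor V Complex.conjAe.toLinearMap

/-- For a complex vector space `V` with complex structure `J v = i v`, the copy
`(v - i J v) / 2` of `v` in the `(1,0)`-part `V'` of `V_ℂ = V' ⊕ V''`. -/
def Cx.hol {V : Type*} [AddCommGroup V] [Module ℂ V] (v : V) : Cx V :=
  (1 / 2 : ℂ) • Cx.mk v (-(Complex.I • v))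

/-- The complex linear extension to `V_ℂ` of a complex linear functional `ℓ` on `V`; it reads off
the `(1,0)`-coefficient, and it vanishes on `V''`. -/
def Cx.coeff {V : Type*} [AddCommGroup V] [Module ℂ V] (l : V →ₗ[ℂ] ℂ) (a : Cx V) : ℂ :=
  l (Cx.re a) + Complex.I * l (Cx.im a)

/-- The complex linear extension to `V_ℂ` of the conjugate of `ℓ`; it reads off the
`(0,1)`-coefficient, and it vanishes on `V'`. -/
def Cx.coeffBar {V : Type*} [AddCommGroup V] [Module ℂ V] (l : V →ₗ[ℂ] ℂ) (a : Cx V) : ℂ :=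
  starRingEnd ℂ (Cx.coeff l (Cx.conj a))

end Complexification

section Setup

variable (n m : ℕ) {M : Type*} [TopologicalSpace M] [ChartedSpace (Fin n → ℂ) M]
  (E : M → Type*) [TopologicalSpace (TotalSpace (Fin m → ℂ) E)]
  [∀ x, AddCommGroup (E x)] [∀ x, Module ℂ (E x)] [∀ x, TopologicalSpace (E x)]
  [FiberBundle (Fin m → ℂ) E]

/-- `s` is a holomorphic section of `E` over `U` (its values outside `U` are irrelevant). -/
def IsHolSection (s : ∀ x, E x) (U : Set M) : Prop :=
  ContMDiffOn 𝓘(ℂ, Fin n → ℂ) (𝓘(ℂ, Fin n → ℂ).prod 𝓘(ℂ, Fin m → ℂ)) ω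
    (fun x => TotalSpace.mk' (Fin m → ℂ) x (s x)) U

/-- The derivative `v f` of a holomorphic function `f` along `v ∈ T'_x M`. -/
def holDeriv (f : M → ℂ) (x : M) (v : TangentSpace 𝓘(ℂ, Fin n → ℂ) x) : ℂ :=
  mfderiv 𝓘(ℂ, Fin n → ℂ) 𝓘(ℂ, ℂ) f x v

/-- A holomorphic Lie algebroid structure on the holomorphic vector bundle `E → M`: a holomorphic
bundle morphism `ρ : E → T'M` (here `T'M` is the complex tangent bundle `TangentSpace` of the
complex manifold `M`), and a Lie bracket on (the sheaf of) holomorphic sections of `E`, with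
`[s, f t] = f [s, t] + ρ(s)(f) t`. Local sections are represented by globally defined functions, of
which only the values on the open set in question matter. -/
structure HolLieAlgebroid [IsManifold 𝓘(ℂ, Fin n → ℂ) ω M] where
  anchor : ∀ x, E x →ₗ[ℂ] TangentSpace 𝓘(ℂ, Fin n → ℂ) x
  anchor_hol : ContMDiff (𝓘(ℂ, Fin n → ℂ).prod 𝓘(ℂ, Fin m → ℂ)) 𝓘(ℂ, Fin n → ℂ).tangent ω
    (fun p : TotalSpace (Fin m → ℂ) E =>
      (⟨p.proj, anchor p.proj p.2⟩ : TangentBundle 𝓘(ℂ, Fin n → ℂ) M))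
  bracket : (∀ x, E x) → (∀ x, E x) → ∀ x, E x
  bracket_hol : ∀ (U : Set M), IsOpen U → ∀ s t : ∀ x, E x,
    IsHolSection n m E s U → IsHolSection n m E t U → IsHolSection n m E (bracket s t) U
  /-- The bracket is compatible with restriction to open subsets. -/
  bracket_congr : ∀ (U : Set M), IsOpen U → ∀ s s' t t' : ∀ x, E x,
    IsHolSection n m E s U → IsHolSection n m E t U →
    (∀ x ∈ U, s x = s' x) → (∀ x ∈ U, t x = t' x) →
    ∀ x ∈ U, bracket s t x = bracket s' t' x
  bracket_add : ∀ (U : Set M), IsOpen U → ∀ s t t' : ∀ x, E x,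
    IsHolSection n m E s U → IsHolSection n m E t U → IsHolSection n m E t' U →
    ∀ x ∈ U, bracket s (t + t') x = bracket s t x + bracket s t' x
  bracket_skew : ∀ (U : Set M), IsOpen U → ∀ s t : ∀ x, E x,
    IsHolSection n m E s U → IsHolSection n m E t U →
    ∀ x ∈ U, bracket s t x = -bracket t s x
  bracket_jacobi : ∀ (U : Set M), IsOpen U → ∀ s t r : ∀ x, E x,
    IsHolSection n m E s U → IsHolSection n m E t U → IsHolSection n m E r U →
    ∀ x ∈ U, bracket s (bracket t r) x = bracket (bracket s t) r x + bracket t (bracket s r) x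
  bracket_leibniz : ∀ (U : Set M), IsOpen U → ∀ (f : M → ℂ) (s t : ∀ x, E x),
    ContMDiffOn 𝓘(ℂ, Fin n → ℂ) 𝓘(ℂ, ℂ) ω f U →
    IsHolSection n m E s U → IsHolSection n m E t U →
    ∀ x ∈ U, bracket s (fun y => f y • t y) x = f x • bracket s t x +
      holDeriv n f x (anchor x (s x)) • t x

/-- A holomorphic chart `z = φ` of `M` on an open set `U = φ.source`, together with a holomorphic
frame `e_α` of `E` over `U`. -/
structure BundleChart where
  φ : OpenPartialHomeomorph M (Fin n → ℂ)
  φ_mem : φ ∈ IsManifold.maximalAtlas 𝓘(ℂ, Fin n → ℂ) ω M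
  e : Fin m → ∀ x, E x
  isFrame : IsLocalFrameOn 𝓘(ℂ, Fin n → ℂ) (Fin m → ℂ) ω e φ.source

/-- The model of the total space of `E` as a real manifold. -/
abbrev RModel := 𝓘(ℝ, Fin n → ℂ).prod 𝓘(ℝ, Fin m → ℂ)

end Setup

section Prolongation

variable {n m : ℕ} {M : Type*} [TopologicalSpace M] [ChartedSpace (Fin n → ℂ) M]
  [IsManifold 𝓘(ℂ, Fin n → ℂ) ω M]
  {E : M → Type*} [TopologicalSpace (TotalSpace (Fin m → ℂ) E)]
  [∀ x, AddCommGroup (E x)] [∀ x, Module ℂ (E x)] [∀ x, TopologicalSpace (E x)]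
  [FiberBundle (Fin m → ℂ) E]

/-- The real tangent space at `p` of the total space of `E`. -/
abbrev RTangent (p : TotalSpace (Fin m → ℂ) E) : Type := TangentSpace (RModel n m) p

/-- The fibre of `E_ℂ × T_ℂ E` at `p ∈ E`, in which the complexified prolongation lies. -/
abbrev Ambient (p : TotalSpace (Fin m → ℂ) E) : Type _ :=
  Cx (E p.proj) × Cx (RTangent (n := n) p)

/-- Complex conjugation on `E_ℂ × T_ℂ E`. -/
def conjA {p : TotalSpace (Fin m → ℂ) E} (x : Ambient (n := n) p) : Ambient (n := n) p :=
  (Cx.conj x.1, Cx.conj x.2)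

/-- The anchor as a real linear map into the real tangent space of `M`. -/
def HolLieAlgebroid.anchorReal (A : HolLieAlgebroid n m E) (x : M) :
    E x →ₗ[ℝ] TangentSpace 𝓘(ℝ, Fin n → ℂ) x :=
  { toFun := fun v => A.anchor x v
    map_add' := fun v w => (A.anchor x).map_add v w
    map_smul' := fun r v => (A.anchor x).map_smul (r : ℂ) v }

/-- The fibre at `p ∈ E` of the complexified prolongation:
`{(a, v) ∈ E_ℂ × T_ℂ E | ρ_ℂ(a) = π_{*,ℂ}(v)}`. Its anchor is the second projection. -/
def prolongation (A : HolLieAlgebroid n m E) (p : TotalSpace (Fin m → ℂ) E) :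
    Submodule ℂ (Ambient (n := n) p) :=
  LinearMap.eqLocus
    (((A.anchorReal p.proj).baseChange ℂ) ∘ₗ
      LinearMap.fst ℂ (Cx (E p.proj)) (Cx (RTangent (n := n) p)))
    (((mfderiv (RModel n m) 𝓘(ℝ, Fin n → ℂ)
        (TotalSpace.proj : TotalSpace (Fin m → ℂ) E → M) p).toLinearMap.baseChange ℂ) ∘ₗ
      LinearMap.snd ℂ (Cx (E p.proj)) (Cx (RTangent (n := n) p)))

/-- The derivative of a complex valued function along a real tangent vector. -/
def rderiv {p : TotalSpace (Fin m → ℂ) E} (v : RTangent (n := n) p)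
    (f : TotalSpace (Fin m → ℂ) E → ℂ) : ℂ :=
  mfderiv (RModel n m) 𝓘(ℝ, ℂ) f p v

/-- The derivative `X f` of a complex valued function along a complexified tangent vector. -/
def cderiv {p : TotalSpace (Fin m → ℂ) E} (X : Cx (RTangent (n := n) p))
    (f : TotalSpace (Fin m → ℂ) E → ℂ) : ℂ :=
  rderiv (Cx.re X) f + Complex.I * rderiv (Cx.im X) f

/-- The Lie bracket of complex vector fields on `E`, i.e. the complex bilinear extension of the
Lie bracket of real vector fields. -/
def cbracket (X Y : ∀ p : TotalSpace (Fin m → ℂ) E, Cx (RTangent (n := n) p))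
    (p : TotalSpace (Fin m → ℂ) E) : Cx (RTangent (n := n) p) :=
  Cx.mk
    (VectorField.mlieBracket (RModel n m) (fun q => Cx.re (X q)) (fun q => Cx.re (Y q)) p -
      VectorField.mlieBracket (RModel n m) (fun q => Cx.im (X q)) (fun q => Cx.im (Y q)) p)
    (VectorField.mlieBracket (RModel n m) (fun q => Cx.re (X q)) (fun q => Cx.im (Y q)) p +
      VectorField.mlieBracket (RModel n m) (fun q => Cx.im (X q)) (fun q => Cx.re (Y q)) p)

section Bracket

variable [VectorBundle ℂ (Fin m → ℂ) E]
  [ContMDiffVectorBundle ω (Fin m → ℂ) E 𝓘(ℂ, Fin n → ℂ)]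

/-- The holomorphic frame of `E` near `x₀` given by the preferred trivialization at `x₀`. -/
def refFrame (x₀ : M) (γ : Fin m) : ∀ x, E x :=
  (trivializationAt (Fin m → ℂ) E x₀).localFrame (Pi.basisFun ℂ (Fin m)) γ

/-- The coefficients with respect to `refFrame x₀`. -/
def refCoeff (x₀ : M) (γ : Fin m) (x : M) : E x →ₗ[ℂ] ℂ :=
  (trivializationAt (Fin m → ℂ) E x₀).localFrameCoeff 𝓘(ℂ, Fin n → ℂ)
    (Pi.basisFun ℂ (Fin m)) γ x

/-- The bracket `[σ, τ]_𝒯` of two sections of the complexified prolongation, with values in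
`E_ℂ × T_ℂ E`. The second component is the Lie bracket of complex vector fields on `E`. For the
first component, write (near `p`) `σ = (∑ a^γ b_γ + ∑ a^γ̄ b_γ̄, X)` and
`τ = (∑ c^γ b_γ + ∑ c^γ̄ b_γ̄, Y)` in a holomorphic frame `b_γ` of `E` and its conjugate; then it is
`∑ a^γ c^ε [b_γ, b_ε] + ∑ (X c^γ - Y a^γ) b_γ + ∑ a^γ̄ c^ε̄ conj [b_γ, b_ε] + ∑ (X c^γ̄ - Y a^γ̄) b_γ̄`.
This is the extension, by the Leibniz rule, complex bilinearity, conjugation and `[s, conj t] = 0`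
for holomorphic sections `s, t` of `E`, of the bracket
`[(s ∘ π, X), (t ∘ π, Y)] = ([s, t] ∘ π, [X, Y])`. -/
def prolongBracket (A : HolLieAlgebroid n m E)
    (σ τ : ∀ p : TotalSpace (Fin m → ℂ) E, Ambient (n := n) p)
    (p : TotalSpace (Fin m → ℂ) E) : Ambient (n := n) p :=
  let b : Fin m → ∀ x, E x := refFrame p.proj
  let l : Fin m → ∀ x, E x →ₗ[ℂ] ℂ := refCoeff (n := n) p.proj
  let a (γ : Fin m) (q : TotalSpace (Fin m → ℂ) E) : ℂ := Cx.coeff (l γ q.proj) (σ q).1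
  let a' (γ : Fin m) (q : TotalSpace (Fin m → ℂ) E) : ℂ := Cx.coeffBar (l γ q.proj) (σ q).1
  let c (γ : Fin m) (q : TotalSpace (Fin m → ℂ) E) : ℂ := Cx.coeff (l γ q.proj) (τ q).1
  let c' (γ : Fin m) (q : TotalSpace (Fin m → ℂ) E) : ℂ := Cx.coeffBar (l γ q.proj) (τ q).1
  (∑ γ, ∑ ε, (a γ p * c ε p) • Cx.hol (A.bracket (b γ) (b ε) p.proj) +
    ∑ γ, (cderiv (σ p).2 (c γ) - cderiv (τ p).2 (a γ)) • Cx.hol (b γ p.proj) +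
    ∑ γ, ∑ ε, (a' γ p * c' ε p) • Cx.conj (Cx.hol (A.bracket (b γ) (b ε) p.proj)) +
    ∑ γ, (cderiv (σ p).2 (c' γ) - cderiv (τ p).2 (a' γ)) • Cx.conj (Cx.hol (b γ p.proj)),
   cbracket (fun q => (σ q).2) (fun q => (τ q).2) p)

end Bracket

/-! ### Local coordinates and the adapted frame -/

namespace BundleChart

variable (c : BundleChart n m E)

/-- The local coordinates `(z^k, u^α)` on `π⁻¹(U)`, where `p = ∑ u^α e_α`. -/
def coord (p : TotalSpace (Fin m → ℂ) E) : (Fin n → ℂ) × (Fin m → ℂ) :=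
  (c.φ p.proj, fun α => c.isFrame.coeff α p.proj p.2)

/-- The real vector field on `π⁻¹(U)` which is the constant `w` in the coordinates `(z, u)`. -/
def coordField (w : (Fin n → ℂ) × (Fin m → ℂ)) (p : TotalSpace (Fin m → ℂ) E) :
    RTangent (n := n) p :=
  VectorField.mpullback (RModel n m) 𝓘(ℝ, (Fin n → ℂ) × (Fin m → ℂ)) c.coord (fun _ => w) p

/-- `∂_k = ∂/∂z^k = (∂/∂x^k - i ∂/∂y^k) / 2`, where `z^k = x^k + i y^k`. -/
def dz (k : Fin n) (p : TotalSpace (Fin m → ℂ) E) : Cx (RTangent (n := n) p) :=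
  (1 / 2 : ℂ) • Cx.mk (c.coordField (Pi.single k 1, 0) p)
    (-c.coordField (Pi.single k Complex.I, 0) p)

/-- `∂̇_α = ∂/∂u^α`. -/
def du (α : Fin m) (p : TotalSpace (Fin m → ℂ) E) : Cx (RTangent (n := n) p) :=
  (1 / 2 : ℂ) • Cx.mk (c.coordField (0, Pi.single α 1) p)
    (-c.coordField (0, Pi.single α Complex.I) p)

/-- The anchor coefficients `ρ^k_α` on `U`: `ρ(e_α) = ρ^k_α ∂/∂z^k`. -/
def rho (A : HolLieAlgebroid n m E) (α : Fin m) (k : Fin n) (x : M) : ℂ :=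
  (mfderiv 𝓘(ℂ, Fin n → ℂ) 𝓘(ℂ, Fin n → ℂ) c.φ x (A.anchor x (c.e α x)) : Fin n → ℂ) k

/-- The structure functions `C^γ_{αβ}` on `U`: `[e_α, e_β] = C^γ_{αβ} e_γ`. -/
def struct (A : HolLieAlgebroid n m E) (α β γ : Fin m) (x : M) : ℂ :=
  c.isFrame.coeff γ x (A.bracket (c.e α) (c.e β) x)

/-- `𝒵_α(u) = (e_α(π(u)), ρ^k_α ∂_k|_u)`. -/
def Z (A : HolLieAlgebroid n m E) (α : Fin m) (p : TotalSpace (Fin m → ℂ) E) :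
    Ambient (n := n) p :=
  (Cx.hol (c.e α p.proj), ∑ k, c.rho A α k p.proj • c.dz k p)

/-- `𝒱_α(u) = (0, ∂̇_α|_u)`. -/
def V (α : Fin m) (p : TotalSpace (Fin m → ℂ) E) : Ambient (n := n) p :=
  (0, c.du α p)

/-- The horizontal element `𝒳_α = 𝒵_α - N_α^β 𝒱_β` of the adapted frame; `N α β` is `N_α^β`. -/
def X (A : HolLieAlgebroid n m E) (N : Fin m → Fin m → TotalSpace (Fin m → ℂ) E → ℂ)
    (α : Fin m) (p : TotalSpace (Fin m → ℂ) E) : Ambient (n := n) p :=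
  c.Z A α p - ∑ β, N α β p • c.V β p

/-- `𝒱_ᾱ`, the conjugate of `𝒱_α`. -/
def Vbar (α : Fin m) (p : TotalSpace (Fin m → ℂ) E) : Ambient (n := n) p :=
  conjA (c.V α p)

/-- `𝒳_ᾱ`, the conjugate of `𝒳_α`. -/
def Xbar (A : HolLieAlgebroid n m E) (N : Fin m → Fin m → TotalSpace (Fin m → ℂ) E → ℂ)
    (α : Fin m) (p : TotalSpace (Fin m → ℂ) E) : Ambient (n := n) p :=
  conjA (c.X A N α p)

/-- `δ_α = ρ^k_α ∂_k - N_α^β ∂̇_β`. -/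
def delta (A : HolLieAlgebroid n m E) (N : Fin m → Fin m → TotalSpace (Fin m → ℂ) E → ℂ)
    (α : Fin m) (p : TotalSpace (Fin m → ℂ) E) : Cx (RTangent (n := n) p) :=
  ∑ k, c.rho A α k p.proj • c.dz k p - ∑ β, N α β p • c.du β p

/-- `R^γ_{αβ} = C^ε_{αβ} N_ε^γ - δ_α N_β^γ + δ_β N_α^γ`. -/
def R (A : HolLieAlgebroid n m E) (N : Fin m → Fin m → TotalSpace (Fin m → ℂ) E → ℂ)
    (α β γ : Fin m) (p : TotalSpace (Fin m → ℂ) E) : ℂ :=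
  ∑ ε, c.struct A α β ε p.proj * N ε γ p - cderiv (c.delta A N α p) (N β γ) +
    cderiv (c.delta A N β p) (N α γ)

end BundleChart

end Prolongation

end HolAlg

end

/-! The two components of the bracket are computed independently.

Second component. A complex vector field on `π⁻¹(U)` is determined by its values on the coordinates
`(z, u)` and by the values of its conjugate on them (`comp_ext`). The Lie bracket acts on functions
as a commutator of derivations (`mvfderiv_mlieBracket`, `cxDeriv_bracket`), so the values of `[X,
Y]` on the coordinates come from differentiating those of `X` and `Y` (`comp_cbracket`). For `δ_α`
these are `(ρ_α, -N_α)` and `0` for its conjugate; for `∂̇_α` they are constant. The derivatives of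
`N` give the vertical terms directly. The functions `ρ^k_α` are holomorphic and come from `M`, so
they are killed by `∂̇_β` and by all the conjugate fields; only `δ_α ρ^k_β - δ_β ρ^k_α` remains. It
equals `C^γ_{αβ} ρ^k_γ`, i.e. the anchor is a Lie algebra homomorphism. This is not an axiom:
comparing the Jacobi identity for `(s, t, f r)` with `f` times that for `(s, t, r)` leaves exactly
the terms in which `f` is differentiated twice or by `ρ([s, t])` (`holDeriv_anchor_bracket`).

First component. It is defined by a formula in a frame that depends on the point. If the sections
project to holomorphic sections `s, t` of `E`, the prolongation condition turns the derivatives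
along `X, Y` into derivatives along `ρ(s), ρ(t)`, and the formula becomes the Leibniz expansion of
`[s, t]_E` (`prolongBracket_fst_of_hol`). For one section of type `(1,0)` and one of type `(0,1)`
all terms vanish, since holomorphic functions have no derivative in conjugate directions. The
adapted frame projects to `e_α`, to `0` and to their conjugates, so these two cases suffice.

The bracket commutes with conjugation (`prolongBracket_conjA`), which yields the remaining formulas.
-/

namespace HolAlg

set_option linter.unusedSectionVars false

/-! ### Complex manifolds and holomorphic maps viewed over the reals -/

section RestrictScalars

variable {E H E' H' : Type*} [NormedAddCommGroup E] [NormedSpace ℂ E] [NormedSpace ℝ E]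
  [IsScalarTower ℝ ℂ E] [TopologicalSpace H]
  [NormedAddCommGroup E'] [NormedSpace ℂ E'] [NormedSpace ℝ E']
  [IsScalarTower ℝ ℂ E'] [TopologicalSpace H']
  {I : ModelWithCorners ℂ E H} {Ir : ModelWithCorners ℝ E H}
  {J : ModelWithCorners ℂ E' H'} {Jr : ModelWithCorners ℝ E' H'}
  {M : Type*} [TopologicalSpace M] [ChartedSpace H M]
  {M' : Type*} [TopologicalSpace M'] [ChartedSpace H' M']

/-- Charts involve a model with corners only through its partial equivalence, not through the scalar
field. This makes the passage from `ℂ` to `ℝ` a mere restriction of scalars in identical charts. -/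
lemma extChartAt_eq_of_toPartialEquiv_eq (hI : I.toPartialEquiv = Ir.toPartialEquiv) (x : M) :
    extChartAt I x = extChartAt Ir x := by
  simp only [extChartAt, OpenPartialHomeomorph.extend, hI]

lemma range_eq_of_toPartialEquiv_eq (hI : I.toPartialEquiv = Ir.toPartialEquiv) :
    Set.range I = Set.range Ir := by
  rw [← I.target_eq, ← Ir.target_eq, hI]

/-- A complex `C^n` map is real `C^n`. -/
theorem contMDiffWithinAt_real (hI : I.toPartialEquiv = Ir.toPartialEquiv)
    (hJ : J.toPartialEquiv = Jr.toPartialEquiv) {n : ℕ∞ω} {f : M → M'} {s : Set M} {x : M}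
    (h : ContMDiffWithinAt I J n f s x) : ContMDiffWithinAt Ir Jr n f s x := by
  rw [contMDiffWithinAt_iff] at h ⊢
  rw [← extChartAt_eq_of_toPartialEquiv_eq hI, ← extChartAt_eq_of_toPartialEquiv_eq hJ,
    ← range_eq_of_toPartialEquiv_eq hI]
  exact ⟨h.1, h.2.restrict_scalars ℝ⟩

theorem contMDiffAt_real (hI : I.toPartialEquiv = Ir.toPartialEquiv)
    (hJ : J.toPartialEquiv = Jr.toPartialEquiv) {n : ℕ∞ω} {f : M → M'} {x : M}
    (h : ContMDiffAt I J n f x) : ContMDiffAt Ir Jr n f x :=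
  contMDiffWithinAt_real hI hJ h

/-- The real derivative of a complex differentiable map is its complex derivative. -/
theorem hasMFDerivAt_real (hI : I.toPartialEquiv = Ir.toPartialEquiv)
    (hJ : J.toPartialEquiv = Jr.toPartialEquiv) {f : M → M'} {x : M} {f' : E →L[ℂ] E'}
    (h : HasMFDerivAt I J f x f') :
    HasMFDerivAt Ir Jr f x (f'.restrictScalars ℝ : E →L[ℝ] E') := by
  refine ⟨h.1, ?_⟩
  have h2 := h.2
  simp only [writtenInExtChartAt] at h2 ⊢
  rw [← extChartAt_eq_of_toPartialEquiv_eq hI, ← extChartAt_eq_of_toPartialEquiv_eq hJ,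
    ← range_eq_of_toPartialEquiv_eq hI]
  exact HasFDerivWithinAt.restrictScalars ℝ (f' := f') h2

/-- A complex manifold is a real manifold. -/
theorem isManifold_real (hI : I.toPartialEquiv = Ir.toPartialEquiv) {n : ℕ∞ω}
    [IsManifold I n M] : IsManifold Ir n M := by
  have h1 : (I : H → E) = Ir := congrArg (fun e : PartialEquiv H E => (e : H → E)) hI
  have h2 : (I.symm : E → H) = Ir.symm :=
    congrArg (fun e : PartialEquiv H E => (e.symm : E → H)) hI
  refine isManifold_of_contDiffOn Ir n M fun e e' he he' => ?_
  have := (contDiffGroupoid n I).compatible (H := H) he he'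
  rw [contDiffGroupoid, mem_groupoid_of_pregroupoid, contDiffPregroupoid] at this
  have := this.1.restrict_scalars ℝ
  rwa [h1, h2] at this

end RestrictScalars

/-! ### The Lie bracket as a commutator of derivations -/

section LieBracket

open VectorField

variable {H E : Type*} [NormedAddCommGroup E] [NormedSpace ℝ E] [CompleteSpace E]
  [TopologicalSpace H] {I : ModelWithCorners ℝ E H} [I.Boundaryless]
  {M : Type*} [TopologicalSpace M] [ChartedSpace H M] [IsManifold I 2 M]
  {F : Type*} [NormedAddCommGroup F] [NormedSpace ℝ F]

lemma mvfderiv_congr {f g : M → F} {p : M} (h : f =ᶠ[nhds p] g) (v : TangentSpace I p) :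
    mvfderiv I f p v = mvfderiv I g p v := by
  change (mfderiv I 𝓘(ℝ, F) f p : E → F) v = (mfderiv I 𝓘(ℝ, F) g p : E → F) v
  rw [h.mfderiv_eq]
  rfl

/-- The chart stays fixed at `p` while `q` varies, so that the expression can be differentiated once
more in `q`. -/
lemma mvfderiv_eq_fderiv_chart {f : M → F} {p q : M}
    (hq : q ∈ (extChartAt I p).source) (hf : MDifferentiableAt I 𝓘(ℝ, F) f q)
    (v : TangentSpace I q) :
    mvfderiv I f q v = fderiv ℝ (f ∘ (extChartAt I p).symm) (extChartAt I p q)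
      (mfderiv I 𝓘(ℝ, E) (extChartAt I p) q v) := by
  set χ := extChartAt I p with hχ
  have hinv : χ.symm (χ q) = q := χ.left_inv hq
  have hs : MDifferentiableAt 𝓘(ℝ, E) I χ.symm (χ q) := by
    have := (contMDiffOn_extChartAt_symm (I := I) (n := 2) p).contMDiffAt
      (x := χ q) ((isOpen_extChartAt_target p).mem_nhds (χ.map_source hq))
    exact this.mdifferentiableAt (by simp)
  have hd : MDifferentiableAt 𝓘(ℝ, E) 𝓘(ℝ, F) (f ∘ χ.symm) (χ q) := by
    refine MDifferentiableAt.comp (I' := I) _ ?_ hs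
    rwa [hinv]
  have hc : MDifferentiableAt I 𝓘(ℝ, E) χ q :=
    mdifferentiableAt_extChartAt (by simpa [hχ] using hq)
  have hev : f =ᶠ[nhds q] (f ∘ χ.symm) ∘ χ := by
    filter_upwards [extChartAt_source_mem_nhds' hq] with y hy
    simp [χ.left_inv hy]
  have : mfderiv I 𝓘(ℝ, F) f q = (mfderiv 𝓘(ℝ, E) 𝓘(ℝ, F) (f ∘ χ.symm) (χ q)).comp
      (mfderiv I 𝓘(ℝ, E) χ q) := by
    rw [hev.mfderiv_eq]; exact mfderiv_comp q hd hc
  change (mfderiv I 𝓘(ℝ, F) f q : E → F) v = _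
  rw [this, mfderiv_eq_fderiv]; rfl

/-- Reduces the action of a vector field to calculus in the model space, simultaneously for all
points near `p`. The explicit form of `Y` is kept because `mlieBracket` is defined through this
pullback. -/
lemma exists_chart_representation {X : ∀ x : M, TangentSpace I x} {f : M → F} {p : M}
    (hX : MDifferentiableAt I I.tangent (fun x => (⟨x, X x⟩ : TangentBundle I M)) p)
    (hf : ContMDiffAt I 𝓘(ℝ, F) 2 f p) :
    ∃ Y : E → E,
      Y = mpullbackWithin 𝓘(ℝ, E) I (extChartAt I p).symm X (Set.range I) ∧
      DifferentiableAt ℝ Y (extChartAt I p p) ∧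
      (mfderiv I 𝓘(ℝ, E) (extChartAt I p) p : E → E) (X p) = Y (extChartAt I p p) ∧
      (fun q => mvfderiv I f q (X q)) =ᶠ[nhds p]
        (fun y => fderiv ℝ (f ∘ (extChartAt I p).symm) y (Y y)) ∘ extChartAt I p := by
  set χ := extChartAt I p with hχ
  set g : E → F := f ∘ χ.symm with hg
  have hsrc : p ∈ χ.source := mem_extChartAt_source p
  refine ⟨_, rfl, ?_, ?_, ?_⟩
  · have h := hX.mdifferentiableWithinAt (s := Set.univ)
      |>.differentiableWithinAt_mpullbackWithin_vectorField
    have hu : χ.symm ⁻¹' Set.univ ∩ Set.range I = Set.univ := by simp [I.range_eq_univ]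
    rw [hu] at h
    exact h.differentiableAt Filter.univ_mem
  · have := (eventuallyEq_mpullback_mpullbackWithin_extChartAt (I := I) (s := Set.univ) (x := p)
      X).self_of_nhdsWithin (Set.mem_univ _)
    rw [this, mpullback_apply]
    exact (isInvertible_mfderiv_extChartAt (I := I) hsrc).self_apply_inverse _
  · have h1 := eventuallyEq_mpullback_mpullbackWithin_extChartAt (I := I) (s := Set.univ) (x := p)
      X
    rw [nhdsWithin_univ] at h1
    have h2 := (contMDiffAt_iff_contMDiffAt_nhds (by simp)).1 hf
    filter_upwards [h1, h2, extChartAt_source_mem_nhds (I := I) p] with q hq1 hq2 hq3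
    rw [mvfderiv_eq_fderiv_chart hq3 (hq2.mdifferentiableAt (by simp))]
    simp only [Function.comp]
    congr 1
    rw [hq1, mpullback_apply]
    exact (isInvertible_mfderiv_extChartAt (I := I) hq3).self_apply_inverse _

lemma contDiffAt_comp_extChartAt_symm {f : M → F} {p : M} (hf : ContMDiffAt I 𝓘(ℝ, F) 2 f p) :
    ContDiffAt ℝ 2 (f ∘ (extChartAt I p).symm) (extChartAt I p p) := by
  have := (contMDiffAt_iff.1 hf).2
  rwa [I.range_eq_univ, contDiffWithinAt_univ] at this

lemma mdifferentiableAt_mvfderiv_apply {X : ∀ x : M, TangentSpace I x} {f : M → F} {p : M}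
    (hX : MDifferentiableAt I I.tangent (fun x => (⟨x, X x⟩ : TangentBundle I M)) p)
    (hf : ContMDiffAt I 𝓘(ℝ, F) 2 f p) :
    MDifferentiableAt I 𝓘(ℝ, F) (fun q => mvfderiv I f q (X q)) p := by
  obtain ⟨Y, -, dY, -, eY⟩ := exists_chart_representation hX hf
  have dg : DifferentiableAt ℝ (fderiv ℝ (f ∘ (extChartAt I p).symm)) (extChartAt I p p) :=
    ((contDiffAt_comp_extChartAt_symm hf).fderiv_right (m := 1)
      (by norm_num)).differentiableAt (by simp)
  refine MDifferentiableAt.congr_of_eventuallyEq ?_ eY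
  exact (dg.clm_apply dY).mdifferentiableAt.comp p
    (mdifferentiableAt_extChartAt (mem_chart_source _ p))

/-- The Lie bracket acts on functions as the commutator of derivations. -/
theorem mvfderiv_mlieBracket {V W : ∀ x : M, TangentSpace I x} {f : M → F} {p : M}
    (hV : MDifferentiableAt I I.tangent (fun x => (⟨x, V x⟩ : TangentBundle I M)) p)
    (hW : MDifferentiableAt I I.tangent (fun x => (⟨x, W x⟩ : TangentBundle I M)) p)
    (hf : ContMDiffAt I 𝓘(ℝ, F) 2 f p) :
    mvfderiv I f p (mlieBracket I V W p) =
      mvfderiv I (fun q => mvfderiv I f q (W q)) p (V p) -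
      mvfderiv I (fun q => mvfderiv I f q (V q)) p (W p) := by
  set χ := extChartAt I p with hχ
  set g : E → F := f ∘ χ.symm with hg
  have hsrc : p ∈ χ.source := mem_extChartAt_source p
  have hgc : ContDiffAt ℝ 2 g (χ p) := contDiffAt_comp_extChartAt_symm hf
  obtain ⟨V', hV', dV, aV, eV⟩ := exists_chart_representation hV hf
  obtain ⟨W', hW', dW, aW, eW⟩ := exists_chart_representation hW hf
  have dg : DifferentiableAt ℝ (fderiv ℝ g) (χ p) :=
    (hgc.fderiv_right (m := 1) (by norm_num)).differentiableAt (by simp)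
  have hfm : MDifferentiableAt I 𝓘(ℝ, F) f p := hf.mdifferentiableAt (by simp)
  have hc : MDifferentiableAt I 𝓘(ℝ, E) χ p := mdifferentiableAt_extChartAt (mem_chart_source _ p)
  -- Product rule for `y ↦ Dg(y)(Y y)`: a second derivative of `g` plus a first derivative of `Y`.
  have deriv_apply : ∀ (Y : E → E) (w : E), DifferentiableAt ℝ Y (χ p) →
      ∀ v : TangentSpace I p, (mfderiv I 𝓘(ℝ, E) χ p : E → E) v = w →
      mvfderiv I ((fun y => fderiv ℝ g y (Y y)) ∘ χ) p v =
        fderiv ℝ (fderiv ℝ g) (χ p) w (Y (χ p)) + fderiv ℝ g (χ p) (fderiv ℝ Y (χ p) w) := by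
    intro Y w hY v hv
    have hd : DifferentiableAt ℝ (fun y => fderiv ℝ g y (Y y)) (χ p) := dg.clm_apply hY
    have : mfderiv I 𝓘(ℝ, F) ((fun y => fderiv ℝ g y (Y y)) ∘ χ) p =
        (mfderiv 𝓘(ℝ, E) 𝓘(ℝ, F) (fun y => fderiv ℝ g y (Y y)) (χ p)).comp
        (mfderiv I 𝓘(ℝ, E) χ p) := mfderiv_comp p hd.mdifferentiableAt hc
    change (mfderiv I 𝓘(ℝ, F) ((fun y => fderiv ℝ g y (Y y)) ∘ χ) p : E → F) v = _
    rw [this, mfderiv_eq_fderiv]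
    change fderiv ℝ (fun y => fderiv ℝ g y (Y y)) (χ p) ((mfderiv I 𝓘(ℝ, E) χ p : E → E) v) = _
    rw [hv, fderiv_clm_apply dg hY]
    simp [add_comm]
  have e1 := (mvfderiv_congr eW (V p)).trans (deriv_apply W' (V' (χ p)) dW (V p) aV)
  have e2 := (mvfderiv_congr eV (W p)).trans (deriv_apply V' (W' (χ p)) dV (W p) aW)
  have hb : (mfderiv I 𝓘(ℝ, E) χ p : E → E) (mlieBracket I V W p) =
      fderiv ℝ W' (χ p) (V' (χ p)) - fderiv ℝ V' (χ p) (W' (χ p)) := by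
    rw [← mlieBracketWithin_univ, mlieBracketWithin_apply]
    rw [← hV', ← hW']
    simp only [Set.preimage_univ, Set.univ_inter, I.range_eq_univ, lieBracketWithin_univ]
    exact (isInvertible_mfderiv_extChartAt (I := I) hsrc).self_apply_inverse _
  -- In the commutator the second derivatives of `g` cancel by symmetry; what is left is the local
  -- formula `DW'(V') - DV'(W')` for the bracket.
  have hsymm := (hgc.isSymmSndFDerivAt (by simp)) (V' (χ p)) (W' (χ p))
  rw [e1, e2, mvfderiv_eq_fderiv_chart hsrc hfm]
  change fderiv ℝ g (χ p) ((mfderiv I 𝓘(ℝ, E) χ p : E → E) (mlieBracket I V W p)) = _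
  rw [hb, map_sub, hsymm]
  abel

end LieBracket

/-! ### Algebra of complexified vector spaces -/

section ComplexificationLemmas

variable {V : Type*} [AddCommGroup V] [Module ℝ V]

@[simp] lemma Cx.re_tmul (c : ℂ) (v : V) : Cx.re (c ⊗ₜ[ℝ] v) = c.re • v := by
  simp [Cx.re]

@[simp] lemma Cx.im_tmul (c : ℂ) (v : V) : Cx.im (c ⊗ₜ[ℝ] v) = c.im • v := by
  simp [Cx.im]

@[simp] lemma Cx.conj_tmul (c : ℂ) (v : V) :
    Cx.conj (c ⊗ₜ[ℝ] v) = (starRingEnd ℂ c) ⊗ₜ[ℝ] v := by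
  simp [Cx.conj]

@[simp] lemma Cx.re_mk (x y : V) : Cx.re (Cx.mk x y) = x := by
  simp [Cx.mk]

@[simp] lemma Cx.im_mk (x y : V) : Cx.im (Cx.mk x y) = y := by
  simp [Cx.mk]

lemma Cx.mk_re_im (X : Cx V) : Cx.mk (Cx.re X) (Cx.im X) = X := by
  induction X using TensorProduct.induction_on with
  | zero => simp [Cx.mk]
  | tmul c v =>
    simp only [Cx.mk, Cx.re_tmul, Cx.im_tmul, ← TensorProduct.smul_tmul, ← TensorProduct.add_tmul]
    congr 1
    apply Complex.ext <;> simp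
  | add x y hx hy =>
    conv_rhs => rw [← hx, ← hy]
    simp only [Cx.mk, map_add, TensorProduct.tmul_add]
    abel

lemma Cx.ext {X Y : Cx V} (hr : Cx.re X = Cx.re Y) (hi : Cx.im X = Cx.im Y) : X = Y := by
  rw [← Cx.mk_re_im X, ← Cx.mk_re_im Y, hr, hi]

@[simp] lemma Cx.re_smul (c : ℂ) (X : Cx V) :
    Cx.re (c • X) = c.re • Cx.re X - c.im • Cx.im X := by
  induction X using TensorProduct.induction_on with
  | zero => simp
  | tmul d v => simp [TensorProduct.smul_tmul', sub_smul, mul_smul]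
  | add x y hx hy => simp only [smul_add, map_add, hx, hy]; abel

@[simp] lemma Cx.im_smul (c : ℂ) (X : Cx V) :
    Cx.im (c • X) = c.re • Cx.im X + c.im • Cx.re X := by
  induction X using TensorProduct.induction_on with
  | zero => simp
  | tmul d v => simp [TensorProduct.smul_tmul', add_smul, mul_smul]
  | add x y hx hy => simp only [smul_add, map_add, hx, hy]; abel

@[simp] lemma Cx.re_conj (X : Cx V) : Cx.re (Cx.conj X) = Cx.re X := by
  induction X using TensorProduct.induction_on with
  | zero => simp
  | tmul d v => simp
  | add x y hx hy => simp only [map_add, hx, hy]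

@[simp] lemma Cx.im_conj (X : Cx V) : Cx.im (Cx.conj X) = -Cx.im X := by
  induction X using TensorProduct.induction_on with
  | zero => simp
  | tmul d v => simp
  | add x y hx hy => simp only [map_add, hx, hy]; abel

@[simp] lemma Cx.conj_conj (X : Cx V) : Cx.conj (Cx.conj X) = X :=
  Cx.ext (by simp) (by simp)

@[simp] lemma Cx.conj_smul (c : ℂ) (X : Cx V) :
    Cx.conj (c • X) = starRingEnd ℂ c • Cx.conj X :=
  Cx.ext (by simp) (by simp; abel)

lemma Cx.conj_mk (x y : V) : Cx.conj (Cx.mk x y) = Cx.mk x (-y) :=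
  Cx.ext (by simp) (by simp)

variable {V : Type*} [AddCommGroup V] [Module ℂ V]

@[simp] lemma Cx.re_hol (v : V) : Cx.re (Cx.hol v) = (1 / 2 : ℝ) • v := by
  simp [Cx.hol]

@[simp] lemma Cx.im_hol (v : V) : Cx.im (Cx.hol v) = -((1 / 2 : ℝ) • (Complex.I • v)) := by
  simp [Cx.hol]

lemma Cx.hol_add (v w : V) : Cx.hol (v + w) = Cx.hol v + Cx.hol w :=
  Cx.ext (by simp) (by simp; abel)

/-- On the `(1,0)`-part the complex structure `J` of `V` and the scalar `i` of `V_ℂ` agree, because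
`J² = -1`. -/
lemma Cx.hol_smul (c : ℂ) (v : V) : Cx.hol (c • v) = c • Cx.hol v := by
  have h : ∀ x : V, c • x = c.re • x + c.im • (Complex.I • x) := by
    intro x
    rw [← Complex.coe_smul, ← Complex.coe_smul, smul_smul, ← add_smul, Complex.re_add_im]
  have hI : ∀ x : V, Complex.I • Complex.I • x = -x := by
    intro x; rw [smul_smul, Complex.I_mul_I, neg_one_smul]
  have hr : ∀ (r : ℝ) (x : V), Complex.I • r • x = r • Complex.I • x := by
    intro r x; rw [smul_comm]
  refine Cx.ext ?_ ?_
  · simp only [Cx.re_hol, Cx.re_smul, Cx.im_hol]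
    rw [h v]
    module
  · simp only [Cx.re_hol, Cx.im_smul, Cx.im_hol]
    rw [h v]
    simp only [smul_add, hr, hI]
    module

/-- `Cx.hol` as a complex linear map onto the `(1,0)`-part. -/
noncomputable def Cx.holLin : V →ₗ[ℂ] Cx V where
  toFun := Cx.hol
  map_add' := Cx.hol_add
  map_smul' := Cx.hol_smul

lemma Cx.hol_zero : Cx.hol (0 : V) = 0 := Cx.holLin.map_zero

lemma Cx.hol_sum {ι : Type*} (s : Finset ι) (f : ι → V) :
    Cx.hol (∑ i ∈ s, f i) = ∑ i ∈ s, Cx.hol (f i) := map_sum Cx.holLin f s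

lemma apply_real_smul (l : V →ₗ[ℂ] ℂ) (r : ℝ) (v : V) : l (r • v) = r * l v := by
  rw [← Complex.coe_smul, map_smul, smul_eq_mul]

@[simp] lemma Cx.coeff_hol (l : V →ₗ[ℂ] ℂ) (v : V) : Cx.coeff l (Cx.hol v) = l v := by
  simp only [Cx.coeff, Cx.re_hol, Cx.im_hol, map_neg, apply_real_smul, map_smul, smul_eq_mul]
  push_cast
  linear_combination (-(1 / 2 : ℂ)) * l v * Complex.I_sq

-- The real part contributes `ℓ(v)/2` and the imaginary part `i · i ℓ(v)/2`, which cancel. All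
-- vanishing statements for holomorphic data in conjugate directions rest on this.
@[simp] lemma Cx.coeff_conj_hol (l : V →ₗ[ℂ] ℂ) (v : V) :
    Cx.coeff l (Cx.conj (Cx.hol v)) = 0 := by
  simp only [Cx.coeff, Cx.re_conj, Cx.im_conj, neg_neg, Cx.re_hol, Cx.im_hol,
    apply_real_smul, map_smul, smul_eq_mul]
  push_cast
  linear_combination (1 / 2 : ℂ) * l v * Complex.I_sq

@[simp] lemma Cx.coeffBar_hol (l : V →ₗ[ℂ] ℂ) (v : V) : Cx.coeffBar l (Cx.hol v) = 0 := by
  simp [Cx.coeffBar]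

lemma Cx.coeffBar_conj (l : V →ₗ[ℂ] ℂ) (a : Cx V) :
    Cx.coeffBar l (Cx.conj a) = starRingEnd ℂ (Cx.coeff l a) := by
  simp [Cx.coeffBar]

lemma Cx.coeff_conj (l : V →ₗ[ℂ] ℂ) (a : Cx V) :
    Cx.coeff l (Cx.conj a) = starRingEnd ℂ (Cx.coeffBar l a) := by
  simp [Cx.coeffBar]

end ComplexificationLemmas

/-! ### Complex vector fields and their action on functions -/

section ComplexVectorFields

open VectorField

variable {H E : Type*} [NormedAddCommGroup E] [NormedSpace ℝ E] [CompleteSpace E]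
  [TopologicalSpace H] {I : ModelWithCorners ℝ E H}
  {M : Type*} [TopologicalSpace M] [ChartedSpace H M] [I.Boundaryless] [IsManifold I 2 M]
  {F : Type*} [NormedAddCommGroup F] [NormedSpace ℂ F] [NormedSpace ℝ F] [IsScalarTower ℝ ℂ F]
  {G : Type*} [NormedAddCommGroup G] [NormedSpace ℂ G] [NormedSpace ℝ G] [IsScalarTower ℝ ℂ G]

variable (I) in
/-- The derivative of a function with values in a complex vector space along complexified tangent
vectors. -/
noncomputable def cxDeriv (f : M → F) (p : M) : Cx (TangentSpace I p) →ₗ[ℂ] F where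
  toFun X := mvfderiv I f p (Cx.re X) + Complex.I • mvfderiv I f p (Cx.im X)
  map_add' X Y := by simp only [map_add, smul_add]; abel
  map_smul' c X := by
    have h : ∀ (r : ℝ) (x : F), (r • x : F) = (r : ℂ) • x := fun r x => by
      rw [← algebraMap_smul ℂ r x]; rfl
    simp only [Cx.re_smul, Cx.im_smul, map_sub, map_add, map_smul, h, RingHom.id_apply]
    conv_rhs => rw [← Complex.re_add_im c]
    simp only [smul_add, add_smul, smul_smul]
    rw [show ((c.re : ℂ) + c.im * Complex.I) * Complex.I = c.re * Complex.I - c.im by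
      linear_combination (c.im : ℂ) * Complex.I_sq]
    module

lemma cxDeriv_apply (f : M → F) (p : M) (X : Cx (TangentSpace I p)) :
    cxDeriv I f p X = mvfderiv I f p (Cx.re X) + Complex.I • mvfderiv I f p (Cx.im X) := rfl

lemma cxDeriv_congr {f g : M → F} {p : M} (h : f =ᶠ[nhds p] g) (X : Cx (TangentSpace I p)) :
    cxDeriv I f p X = cxDeriv I g p X := by
  rw [cxDeriv_apply, cxDeriv_apply, mvfderiv_congr h, mvfderiv_congr h]

@[simp] lemma cxDeriv_const (c : F) (p : M) (X : Cx (TangentSpace I p)) :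
    cxDeriv I (fun _ : M => c) p X = 0 := by
  simp [cxDeriv_apply, mvfderiv_const]

lemma mvfderiv_clm_comp (L : F →L[ℝ] G) {f : M → F} {p : M}
    (hf : MDifferentiableAt I 𝓘(ℝ, F) f p) (v : TangentSpace I p) :
    mvfderiv I (fun q => L (f q)) p v = L (mvfderiv I f p v) := by
  have : mfderiv I 𝓘(ℝ, G) (L ∘ f) p =
      (mfderiv 𝓘(ℝ, F) 𝓘(ℝ, G) L (f p)).comp (mfderiv I 𝓘(ℝ, F) f p) :=
    mfderiv_comp p L.differentiableAt.mdifferentiableAt hf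
  change (mfderiv I 𝓘(ℝ, G) (L ∘ f) p : E → G) v = _
  rw [this, mfderiv_eq_fderiv, L.fderiv]
  rfl

lemma cxDeriv_clm_comp (L : F →L[ℂ] G) {f : M → F} {p : M}
    (hf : MDifferentiableAt I 𝓘(ℝ, F) f p) (X : Cx (TangentSpace I p)) :
    cxDeriv I (fun q => L (f q)) p X = L (cxDeriv I f p X) := by
  have h := mvfderiv_clm_comp (G := G) (L.restrictScalars ℝ) hf
  simp only [ContinuousLinearMap.coe_restrictScalars'] at h
  simp only [cxDeriv_apply, h, map_add, map_smul]

/-- Derivatives along conjugate vectors of conjugate functions. -/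
lemma cxDeriv_star (f : M → ℂ) (p : M) (X : Cx (TangentSpace I p)) :
    cxDeriv I (fun q => starRingEnd ℂ (f q)) p X = starRingEnd ℂ (cxDeriv I f p (Cx.conj X)) := by
  have key : ∀ v, mvfderiv I (fun q => starRingEnd ℂ (f q)) p v =
      starRingEnd ℂ (mvfderiv I f p v) := by
    intro v
    -- `f` and its conjugate are differentiable at the same points; elsewhere both derivatives take
    -- the default value `0`. Hence no regularity of `f` is required.
    by_cases hf : MDifferentiableAt I 𝓘(ℝ, ℂ) f p
    · exact mvfderiv_clm_comp (Complex.conjCLE : ℂ →L[ℝ] ℂ) hf v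
    · have hg : ¬ MDifferentiableAt I 𝓘(ℝ, ℂ) (fun q => starRingEnd ℂ (f q)) p := by
        intro h
        apply hf
        have := (Complex.conjCLE : ℂ →L[ℝ] ℂ).differentiableAt.mdifferentiableAt.comp p h
        refine this.congr_of_eventuallyEq (Filter.Eventually.of_forall fun q => ?_)
        simp
      simp [mvfderiv, mfderiv_zero_of_not_mdifferentiableAt hf,
        mfderiv_zero_of_not_mdifferentiableAt hg]
  simp [cxDeriv_apply, key]

/-- A complex vector field is differentiable at a point if its real and imaginary parts are. -/
structure CxMDiffAt (X : ∀ q : M, Cx (TangentSpace I q)) (p : M) : Prop where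
  re : MDifferentiableAt I I.tangent (fun q => (⟨q, Cx.re (X q)⟩ : TangentBundle I M)) p
  im : MDifferentiableAt I I.tangent (fun q => (⟨q, Cx.im (X q)⟩ : TangentBundle I M)) p

lemma CxMDiffAt.conj {X : ∀ q : M, Cx (TangentSpace I q)} {p : M}
    (hX : CxMDiffAt X p) : CxMDiffAt (fun q => Cx.conj (X q)) p := by
  refine ⟨by simpa using hX.re, ?_⟩
  simp only [Cx.im_conj]
  exact mdifferentiableAt_neg_section hX.im

lemma CxMDiffAt.add {X Y : ∀ q : M, Cx (TangentSpace I q)} {p : M}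
    (hX : CxMDiffAt X p) (hY : CxMDiffAt Y p) : CxMDiffAt (fun q => X q + Y q) p := by
  refine ⟨?_, ?_⟩
  · simp only [map_add]
    exact mdifferentiableAt_add_section hX.re hY.re
  · simp only [map_add]
    exact mdifferentiableAt_add_section hX.im hY.im

lemma CxMDiffAt.smul {X : ∀ q : M, Cx (TangentSpace I q)} {p : M}
    (hX : CxMDiffAt X p) {f : M → ℂ} (hf : MDifferentiableAt I 𝓘(ℝ, ℂ) f p) :
    CxMDiffAt (fun q => f q • X q) p := by
  have hre : MDifferentiableAt I 𝓘(ℝ, ℝ) (fun q => (f q).re) p :=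
    Complex.reCLM.differentiableAt.mdifferentiableAt.comp p hf
  have him : MDifferentiableAt I 𝓘(ℝ, ℝ) (fun q => (f q).im) p :=
    Complex.imCLM.differentiableAt.mdifferentiableAt.comp p hf
  refine ⟨?_, ?_⟩
  · simp only [Cx.re_smul]
    exact mdifferentiableAt_sub_section (hre.smul_section hX.re) (him.smul_section hX.im)
  · simp only [Cx.im_smul]
    exact mdifferentiableAt_add_section (hre.smul_section hX.im) (him.smul_section hX.re)

lemma CxMDiffAt.sub {X Y : ∀ q : M, Cx (TangentSpace I q)} {p : M}
    (hX : CxMDiffAt X p) (hY : CxMDiffAt Y p) : CxMDiffAt (fun q => X q - Y q) p := by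
  refine ⟨?_, ?_⟩
  · simp only [map_sub]
    exact mdifferentiableAt_sub_section hX.re hY.re
  · simp only [map_sub]
    exact mdifferentiableAt_sub_section hX.im hY.im

lemma CxMDiffAt.sum {ι : Type*} {s : Finset ι} {X : ι → ∀ q : M, Cx (TangentSpace I q)} {p : M}
    (hX : ∀ i ∈ s, CxMDiffAt (X i) p) :
    CxMDiffAt (fun q => ∑ i ∈ s, X i q) p := by
  refine ⟨?_, ?_⟩
  · simp only [map_sum]
    exact MDifferentiableAt.sum_section fun i hi => (hX i hi).re
  · simp only [map_sum]
    exact MDifferentiableAt.sum_section fun i hi => (hX i hi).im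

lemma CxMDiffAt.cxDeriv {X : ∀ q : M, Cx (TangentSpace I q)} {p : M} (hX : CxMDiffAt X p)
    {f : M → F} (hf : ContMDiffAt I 𝓘(ℝ, F) 2 f p) :
    MDifferentiableAt I 𝓘(ℝ, F) (fun q => cxDeriv I f q (X q)) p := by
  have h1 := mdifferentiableAt_mvfderiv_apply hX.re hf
  have h2 := mdifferentiableAt_mvfderiv_apply hX.im hf
  have h3 : MDifferentiableAt I 𝓘(ℝ, F)
      (fun q => Complex.I • mvfderiv I f q (Cx.im (X q))) p :=
    ((Complex.I • ContinuousLinearMap.id ℂ F).restrictScalars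
      ℝ).differentiableAt.mdifferentiableAt.comp p h2
  exact h1.add h3

/-- The complex bilinear extension of the Lie bracket acts on functions as the commutator of
derivations. -/
theorem cxDeriv_bracket {X Y : ∀ q : M, Cx (TangentSpace I q)} {p : M} (hX : CxMDiffAt X p)
    (hY : CxMDiffAt Y p) {f : M → F} (hf : ContMDiffAt I 𝓘(ℝ, F) 2 f p) :
    cxDeriv I f p (Cx.mk
      (mlieBracket I (fun q => Cx.re (X q)) (fun q => Cx.re (Y q)) p -
        mlieBracket I (fun q => Cx.im (X q)) (fun q => Cx.im (Y q)) p)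
      (mlieBracket I (fun q => Cx.re (X q)) (fun q => Cx.im (Y q)) p +
        mlieBracket I (fun q => Cx.im (X q)) (fun q => Cx.re (Y q)) p)) =
      cxDeriv I (fun q => cxDeriv I f q (Y q)) p (X p) -
        cxDeriv I (fun q => cxDeriv I f q (X q)) p (Y p) := by
  have expand : ∀ {Z : ∀ q : M, Cx (TangentSpace I q)}, CxMDiffAt Z p → ∀ v : TangentSpace I p,
      mvfderiv I (fun q => cxDeriv I f q (Z q)) p v =
        mvfderiv I (fun q => mvfderiv I f q (Cx.re (Z q))) p v +
        Complex.I • mvfderiv I (fun q => mvfderiv I f q (Cx.im (Z q))) p v := by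
    intro Z hZ v
    have h1 := mdifferentiableAt_mvfderiv_apply hZ.re hf
    have h2 := mdifferentiableAt_mvfderiv_apply hZ.im hf
    have h3 : MDifferentiableAt I 𝓘(ℝ, F)
        (fun q => Complex.I • mvfderiv I f q (Cx.im (Z q))) p :=
      ((Complex.I • ContinuousLinearMap.id ℂ F).restrictScalars
        ℝ).differentiableAt.mdifferentiableAt.comp p h2
    have h4 := mvfderiv_clm_comp (G := F)
      ((Complex.I • ContinuousLinearMap.id ℂ F).restrictScalars ℝ) h2 v
    have h5 : mvfderiv I (fun q => mvfderiv I f q (Cx.re (Z q)) +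
        Complex.I • mvfderiv I f q (Cx.im (Z q))) p v = _ :=
      DFunLike.congr_fun (mvfderiv_fun_add h1 h3) v
    refine h5.trans ?_
    exact congrArg _ h4
  rw [cxDeriv_apply f, Cx.re_mk, Cx.im_mk, map_sub, map_add,
    mvfderiv_mlieBracket hX.re hY.re hf, mvfderiv_mlieBracket hX.im hY.im hf,
    mvfderiv_mlieBracket hX.re hY.im hf, mvfderiv_mlieBracket hX.im hY.re hf,
    cxDeriv_apply _ _ (X p), cxDeriv_apply _ _ (Y p), expand hX, expand hX, expand hY, expand hY]
  -- Only bilinearity is left; `i² = -1` gives the bracket of the two imaginary parts its minus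
  -- sign.
  simp only [smul_add, smul_sub, smul_smul, Complex.I_mul_I]
  module

end ComplexVectorFields

/-! ### Coordinates on the total space of `E` -/

section TotalSpaceManifold

variable {n m : ℕ} {M : Type*} [TopologicalSpace M] [ChartedSpace (Fin n → ℂ) M]
  [IsManifold 𝓘(ℂ, Fin n → ℂ) ω M]
  {E : M → Type*} [TopologicalSpace (TotalSpace (Fin m → ℂ) E)]
  [∀ x, AddCommGroup (E x)] [∀ x, Module ℂ (E x)] [∀ x, TopologicalSpace (E x)]
  [FiberBundle (Fin m → ℂ) E] [VectorBundle ℂ (Fin m → ℂ) E]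
  [ContMDiffVectorBundle ω (Fin m → ℂ) E 𝓘(ℂ, Fin n → ℂ)]

/-- The model of the total space of `E` as a complex manifold. -/
noncomputable abbrev CModel (n m : ℕ) := 𝓘(ℂ, Fin n → ℂ).prod 𝓘(ℂ, Fin m → ℂ)

lemma cmodel_toPartialEquiv : (CModel n m).toPartialEquiv = (RModel n m).toPartialEquiv := rfl

lemma modelSelf_toPartialEquiv (F : Type*) [NormedAddCommGroup F] [NormedSpace ℂ F]
    [NormedSpace ℝ F] : (𝓘(ℂ, F)).toPartialEquiv = (𝓘(ℝ, F)).toPartialEquiv := rfl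

instance isManifold_totalSpace_real :
    IsManifold (RModel n m) 2 (TotalSpace (Fin m → ℂ) E) := by
  have : IsManifold (CModel n m) ω (TotalSpace (Fin m → ℂ) E) :=
    Bundle.TotalSpace.isManifold (Fin m → ℂ) E
  have : IsManifold (RModel n m) ω (TotalSpace (Fin m → ℂ) E) :=
    isManifold_real cmodel_toPartialEquiv
  exact IsManifold.of_le (n := ω) le_top

lemma isInvertible_of_injective {F : Type*} [NormedAddCommGroup F] [NormedSpace ℝ F]
    [FiniteDimensional ℝ F] (f : F →L[ℝ] F) (hf : Function.Injective f) : f.IsInvertible :=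
  ⟨(LinearEquiv.ofInjectiveEndo f.toLinearMap hf).toContinuousLinearEquiv, by ext; rfl⟩

namespace BundleChart

variable (c : BundleChart n m E)

/-- The frame `c.e`, read in the trivialization at `x₀`, as a linear map on `ℂ^m`. -/
noncomputable def frameMap (x₀ x : M) : (Fin m → ℂ) →L[ℂ] (Fin m → ℂ) :=
  ∑ α, (ContinuousLinearMap.proj (R := ℂ) (φ := fun _ : Fin m => ℂ) α).smulRight
    (trivializationAt (Fin m → ℂ) E x₀ ⟨x, c.e α x⟩).2

lemma contMDiffAt_frameMap {x₀ x : M} (hx : x ∈ c.φ.source)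
    (hx' : x ∈ (trivializationAt (Fin m → ℂ) E x₀).baseSet) :
    ContMDiffAt 𝓘(ℂ, Fin n → ℂ) 𝓘(ℂ, (Fin m → ℂ) →L[ℂ] (Fin m → ℂ)) ω (c.frameMap x₀) x := by
  have h : ∀ α, ContMDiffAt 𝓘(ℂ, Fin n → ℂ) 𝓘(ℂ, Fin m → ℂ) ω
      (fun y => (trivializationAt (Fin m → ℂ) E x₀ ⟨y, c.e α y⟩).2) x := fun α =>
    ((trivializationAt (Fin m → ℂ) E x₀).contMDiffAt_section_iff hx').1
      (c.isFrame.contMDiffAt c.φ.open_source hx α)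
  have h2 : ∀ α, ContMDiffAt 𝓘(ℂ, Fin n → ℂ) 𝓘(ℂ, (Fin m → ℂ) →L[ℂ] (Fin m → ℂ)) ω
      (fun y => (ContinuousLinearMap.proj (R := ℂ) (φ := fun _ : Fin m => ℂ) α).smulRight
        (trivializationAt (Fin m → ℂ) E x₀ ⟨y, c.e α y⟩).2) x := fun α =>
    (ContinuousLinearMap.smulRightL ℂ (Fin m → ℂ) (Fin m → ℂ)
      (ContinuousLinearMap.proj α)).contDiff.contDiffAt.contMDiffAt.comp x (h α)
  exact ContMDiffAt.sum fun α _ => h2 α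

/-- Relates the fibre coordinates `u^α` to those of a trivialization, whose regularity is known. -/
lemma frameMap_coeff {x₀ : M} {q : TotalSpace (Fin m → ℂ) E} (hq : q.proj ∈ c.φ.source)
    (hq' : q.proj ∈ (trivializationAt (Fin m → ℂ) E x₀).baseSet) :
    c.frameMap x₀ q.proj (c.coord q).2 = (trivializationAt (Fin m → ℂ) E x₀ q).2 := by
  obtain ⟨x, v⟩ := q
  have hl : ∀ w : E x, (trivializationAt (Fin m → ℂ) E x₀ ⟨x, w⟩).2 =
      (trivializationAt (Fin m → ℂ) E x₀).linearEquivAt ℂ x hq' w := fun w => rfl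
  have hv : v = ∑ α, c.isFrame.coeff α x v • c.e α x := by
    simpa [IsLocalFrameOn.coeff, hq] using ((c.isFrame.toBasisAt hq).sum_repr v).symm
  simp only [frameMap, coord, _root_.sum_apply, hl,
    ContinuousLinearMap.smulRight_apply, ContinuousLinearMap.proj_apply]
  conv_rhs => rw [hv, map_sum]
  simp only [map_smul]

lemma isInvertible_frameMap {x₀ x : M} (hx : x ∈ c.φ.source)
    (hx' : x ∈ (trivializationAt (Fin m → ℂ) E x₀).baseSet) :
    (c.frameMap x₀ x).IsInvertible := by
  let L : (Fin m → ℂ) ≃ₗ[ℂ] (Fin m → ℂ) := (c.isFrame.toBasisAt hx).equivFun.symm.trans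
    ((trivializationAt (Fin m → ℂ) E x₀).linearEquivAt ℂ x hx')
  refine ⟨L.toContinuousLinearEquiv, ?_⟩
  ext u : 1
  have hl : ∀ w : E x, (trivializationAt (Fin m → ℂ) E x₀ ⟨x, w⟩).2 =
      (trivializationAt (Fin m → ℂ) E x₀).linearEquivAt ℂ x hx' w := fun w => rfl
  change L u = _
  simp only [L, frameMap, hl, LinearEquiv.trans_apply, Module.Basis.equivFun_symm_apply, map_sum,
    map_smul, _root_.sum_apply, ContinuousLinearMap.smulRight_apply,
    ContinuousLinearMap.proj_apply, IsLocalFrameOn.toBasisAt_coe]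

lemma contMDiffAt_trivialization_snd {x₀ : M} {p : TotalSpace (Fin m → ℂ) E}
    (hp : p.proj ∈ (trivializationAt (Fin m → ℂ) E x₀).baseSet) :
    ContMDiffAt (CModel n m) 𝓘(ℂ, Fin m → ℂ) ω
      (fun q : TotalSpace (Fin m → ℂ) E => (trivializationAt (Fin m → ℂ) E x₀ q).2) p :=
  contMDiffAt_snd.comp p ((trivializationAt (Fin m → ℂ) E x₀).contMDiffOn.contMDiffAt
    ((trivializationAt (Fin m → ℂ) E x₀).open_source.mem_nhds
      ((trivializationAt (Fin m → ℂ) E x₀).mem_source.2 hp)))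

lemma eventually_proj_mem {p : TotalSpace (Fin m → ℂ) E} {U : Set M} (hU : IsOpen U)
    (hp : p.proj ∈ U) : ∀ᶠ q : TotalSpace (Fin m → ℂ) E in nhds p, q.proj ∈ U :=
  (FiberBundle.continuous_proj (Fin m → ℂ) E).continuousAt.eventually (hU.mem_nhds hp)

lemma contMDiffAt_coord {p : TotalSpace (Fin m → ℂ) E} (hp : p.proj ∈ c.φ.source) :
    ContMDiffAt (CModel n m) 𝓘(ℂ, (Fin n → ℂ) × (Fin m → ℂ)) ω c.coord p := by
  have hproj : ContMDiffAt (CModel n m) 𝓘(ℂ, Fin n → ℂ) ω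
      (TotalSpace.proj : TotalSpace (Fin m → ℂ) E → M) p := contMDiffAt_proj E
  have hb : p.proj ∈ (trivializationAt (Fin m → ℂ) E p.proj).baseSet :=
    mem_baseSet_trivializationAt _ _ _
  have h1 : ContMDiffAt (CModel n m) 𝓘(ℂ, Fin n → ℂ) ω (fun q => (c.coord q).1) p :=
    ((contMDiffOn_of_mem_maximalAtlas c.φ_mem).contMDiffAt
      (c.φ.open_source.mem_nhds hp)).comp p hproj
  have h2 : ContMDiffAt (CModel n m) 𝓘(ℂ, Fin m → ℂ) ω (fun q => (c.coord q).2) p := by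
    -- The `u^α` are obtained by applying the inverse of `frameMap` to the fibre part of the
    -- trivialization, and inversion of linear maps is analytic at invertible ones.
    have hA : ContMDiffAt (CModel n m) 𝓘(ℂ, (Fin m → ℂ) →L[ℂ] (Fin m → ℂ)) ω
        (fun q : TotalSpace (Fin m → ℂ) E => (c.frameMap p.proj q.proj).inverse) p := by
      obtain ⟨L, hL⟩ := c.isInvertible_frameMap hp hb
      have hi : ContDiffAt ℂ ω ContinuousLinearMap.inverse (c.frameMap p.proj p.proj) := by
        rw [← hL]; exact contDiffAt_map_inverse L
      exact (hi.contMDiffAt.comp p.proj (c.contMDiffAt_frameMap hp hb)).comp p hproj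
    refine (hA.clm_apply (contMDiffAt_trivialization_snd hb)).congr_of_eventuallyEq ?_
    filter_upwards [eventually_proj_mem c.φ.open_source hp,
      eventually_proj_mem (trivializationAt (Fin m → ℂ) E p.proj).open_baseSet hb] with q hq hq'
    rw [← c.frameMap_coeff hq hq']
    exact ((c.isInvertible_frameMap hq hq').inverse_apply_self _).symm
  exact h1.prodMk_space h2

lemma contMDiffAt_coord_real {p : TotalSpace (Fin m → ℂ) E} (hp : p.proj ∈ c.φ.source) :
    ContMDiffAt (RModel n m) 𝓘(ℝ, (Fin n → ℂ) × (Fin m → ℂ)) ω c.coord p :=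
  contMDiffAt_real cmodel_toPartialEquiv (modelSelf_toPartialEquiv _) (c.contMDiffAt_coord hp)

/-- Near `p` the preferred chart of the total space factors as `Θ ∘ coord`, with `Θ` differentiable.
Its differential is invertible, so that of `coord` is injective, hence invertible by equality of
finite dimensions. -/
lemma isInvertible_mfderiv_coord {p : TotalSpace (Fin m → ℂ) E} (hp : p.proj ∈ c.φ.source) :
    (mfderiv (RModel n m) 𝓘(ℝ, (Fin n → ℂ) × (Fin m → ℂ)) c.coord p).IsInvertible := by
  set F := (Fin n → ℂ) × (Fin m → ℂ)
  have hb : p.proj ∈ (trivializationAt (Fin m → ℂ) E p.proj).baseSet :=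
    mem_baseSet_trivializationAt _ _ _
  let Θ : F → F := fun y =>
    (extChartAt 𝓘(ℂ, Fin n → ℂ) p.proj (c.φ.symm y.1), c.frameMap p.proj (c.φ.symm y.1) y.2)
  have hsymm : ContMDiffAt 𝓘(ℂ, F) 𝓘(ℂ, Fin n → ℂ) ω (fun y : F => c.φ.symm y.1) (c.coord p) :=
    ((contMDiffOn_symm_of_mem_maximalAtlas c.φ_mem).contMDiffAt
      (c.φ.open_target.mem_nhds (c.φ.map_source hp))).comp (c.coord p)
      contDiff_fst.contDiffAt.contMDiffAt
  have hinv : c.φ.symm (c.coord p).1 = p.proj := c.φ.left_inv hp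
  have h1 : ContMDiffAt 𝓘(ℂ, F) 𝓘(ℂ, Fin n → ℂ) ω (fun y => (Θ y).1) (c.coord p) :=
    ContMDiffAt.comp_of_eq (g := extChartAt 𝓘(ℂ, Fin n → ℂ) p.proj) contMDiffAt_extChartAt
      hsymm hinv
  have h2 : ContMDiffAt 𝓘(ℂ, F) 𝓘(ℂ, Fin m → ℂ) ω (fun y => (Θ y).2) (c.coord p) := by
    have : ContMDiffAt 𝓘(ℂ, F) 𝓘(ℂ, (Fin m → ℂ) →L[ℂ] (Fin m → ℂ)) ω
        (fun y : F => c.frameMap p.proj (c.φ.symm y.1)) (c.coord p) :=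
      ContMDiffAt.comp_of_eq (g := c.frameMap p.proj) (c.contMDiffAt_frameMap hp hb) hsymm hinv
    exact this.clm_apply contDiff_snd.contDiffAt.contMDiffAt
  have hΘ : MDifferentiableAt 𝓘(ℝ, F) 𝓘(ℝ, F) Θ (c.coord p) :=
    (contMDiffAt_real (modelSelf_toPartialEquiv _) (modelSelf_toPartialEquiv _)
      (h1.prodMk_space h2)).mdifferentiableAt (by simp)
  have hev : (extChartAt (RModel n m) p : TotalSpace (Fin m → ℂ) E → F) =ᶠ[nhds p]
      Θ ∘ c.coord := by
    filter_upwards [eventually_proj_mem c.φ.open_source hp,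
      eventually_proj_mem (trivializationAt (Fin m → ℂ) E p.proj).open_baseSet hb] with q hq hq'
    have hinv' : c.φ.symm (c.coord q).1 = q.proj := c.φ.left_inv hq
    have hΘq : Θ (c.coord q) = (extChartAt 𝓘(ℂ, Fin n → ℂ) p.proj q.proj,
        (trivializationAt (Fin m → ℂ) E p.proj q).2) := by
      simp only [Θ, hinv', c.frameMap_coeff hq hq']
    rw [Function.comp, hΘq, FiberBundle.extChartAt]
    refine Prod.ext ?_ rfl
    change extChartAt 𝓘(ℂ, Fin n → ℂ) p.proj (trivializationAt (Fin m → ℂ) E p.proj q).1 = _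
    rw [(trivializationAt (Fin m → ℂ) E p.proj).coe_fst' hq']
  have hcomp : mfderiv (RModel n m) 𝓘(ℝ, F) (extChartAt (RModel n m) p) p =
      (mfderiv 𝓘(ℝ, F) 𝓘(ℝ, F) Θ (c.coord p)).comp (mfderiv (RModel n m) 𝓘(ℝ, F) c.coord p) := by
    rw [hev.mfderiv_eq]
    exact mfderiv_comp p hΘ ((c.contMDiffAt_coord_real hp).mdifferentiableAt (by simp))
  have hchart := isInvertible_mfderiv_extChartAt (I := RModel n m) (mem_extChartAt_source p)
  refine isInvertible_of_injective (F := F) (mfderiv (RModel n m) 𝓘(ℝ, F) c.coord p) ?_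
  have hinj := hchart.injective
  rw [hcomp] at hinj
  exact Function.Injective.of_comp hinj

lemma mvfderiv_coord_coordField {p : TotalSpace (Fin m → ℂ) E} (hp : p.proj ∈ c.φ.source)
    (w : (Fin n → ℂ) × (Fin m → ℂ)) :
    mvfderiv (RModel n m) c.coord p (c.coordField w p) = w :=
  (c.isInvertible_mfderiv_coord hp).self_apply_inverse w

lemma mvfderiv_coord_injective {p : TotalSpace (Fin m → ℂ) E} (hp : p.proj ∈ c.φ.source) :
    Function.Injective (mvfderiv (RModel n m) c.coord p) :=
  (c.isInvertible_mfderiv_coord hp).injective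

end BundleChart
end TotalSpaceManifold

/-! ### Values of complex tangent vectors on the coordinates -/

section AdaptedFrame

variable {n m : ℕ} {M : Type*} [TopologicalSpace M] [ChartedSpace (Fin n → ℂ) M]
  [IsManifold 𝓘(ℂ, Fin n → ℂ) ω M]
  {E : M → Type*} [TopologicalSpace (TotalSpace (Fin m → ℂ) E)]
  [∀ x, AddCommGroup (E x)] [∀ x, Module ℂ (E x)] [∀ x, TopologicalSpace (E x)]
  [FiberBundle (Fin m → ℂ) E] [VectorBundle ℂ (Fin m → ℂ) E]
  [ContMDiffVectorBundle ω (Fin m → ℂ) E 𝓘(ℂ, Fin n → ℂ)]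

lemma cderiv_eq_cxDeriv {p : TotalSpace (Fin m → ℂ) E} (X : Cx (RTangent (n := n) p))
    (f : TotalSpace (Fin m → ℂ) E → ℂ) : cderiv X f = cxDeriv (RModel n m) f p X := rfl

namespace BundleChart

variable (c : BundleChart n m E)

/-- The value of a complexified tangent vector on the holomorphic coordinates. -/
noncomputable def comp (p : TotalSpace (Fin m → ℂ) E) :
    Cx (RTangent (n := n) p) →ₗ[ℂ] (Fin n → ℂ) × (Fin m → ℂ) :=
  cxDeriv (RModel n m) c.coord p

lemma comp_mk (p : TotalSpace (Fin m → ℂ) E) (v w : RTangent (n := n) p) :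
    c.comp p (Cx.mk v w) = mvfderiv (RModel n m) c.coord p v +
      Complex.I • mvfderiv (RModel n m) c.coord p w := by
  simp [comp, cxDeriv_apply]

variable {p : TotalSpace (Fin m → ℂ) E}

lemma coord_re (X : Cx (RTangent (n := n) p)) :
    mvfderiv (RModel n m) c.coord p (Cx.re X) =
      (1 / 2 : ℂ) • (c.comp p X + c.comp p (Cx.conj X)) := by
  simp only [comp, cxDeriv_apply, Cx.re_conj, Cx.im_conj, map_neg]
  module

lemma coord_im (X : Cx (RTangent (n := n) p)) :
    mvfderiv (RModel n m) c.coord p (Cx.im X) =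
      (-Complex.I / 2 : ℂ) • (c.comp p X - c.comp p (Cx.conj X)) := by
  simp only [comp, cxDeriv_apply, Cx.re_conj, Cx.im_conj, map_neg]
  rw [show ∀ a b : (Fin n → ℂ) × (Fin m → ℂ), a + Complex.I • b - (a + Complex.I • -b) =
    (2 * Complex.I) • b by intro a b; module, smul_smul,
    show -Complex.I / 2 * (2 * Complex.I) = 1 by linear_combination -Complex.I_sq, one_smul]

/-- Vectors of type `(0,1)` have zero value on holomorphic coordinates, so the conjugates must be
compared too. The two values together recover the real and imaginary parts, on which the
differential of the coordinates is injective. -/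
lemma comp_ext (hp : p.proj ∈ c.φ.source) {X Y : Cx (RTangent (n := n) p)}
    (h : c.comp p X = c.comp p Y) (h' : c.comp p (Cx.conj X) = c.comp p (Cx.conj Y)) : X = Y := by
  refine Cx.ext (c.mvfderiv_coord_injective hp ?_) (c.mvfderiv_coord_injective hp ?_)
  · rw [coord_re, coord_re, h, h']
  · rw [coord_im, coord_im, h, h']

/-- Common computation for `∂_k` and `∂̇_α`: `(v - i J v)/2` is the type `(1,0)` vector belonging to
`v`. -/
lemma comp_half_mk_coordField (hp : p.proj ∈ c.φ.source) {v w : (Fin n → ℂ) × (Fin m → ℂ)}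
    (hw : w = Complex.I • v) :
    c.comp p ((1 / 2 : ℂ) • Cx.mk (c.coordField v p) (-c.coordField w p)) = v ∧
    c.comp p (Cx.conj ((1 / 2 : ℂ) • Cx.mk (c.coordField v p) (-c.coordField w p))) = 0 := by
  subst hw
  constructor
  · rw [map_smul, comp_mk, map_neg, c.mvfderiv_coord_coordField hp,
      c.mvfderiv_coord_coordField hp, smul_neg, smul_smul, Complex.I_mul_I]
    module
  · rw [Cx.conj_smul, Cx.conj_mk, map_smul, comp_mk, neg_neg, c.mvfderiv_coord_coordField hp,
      c.mvfderiv_coord_coordField hp, smul_smul, Complex.I_mul_I]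
    module

lemma single_I_fst (k : Fin n) : ((Pi.single k Complex.I, 0) : (Fin n → ℂ) × (Fin m → ℂ)) =
    Complex.I • ((Pi.single k 1, 0) : (Fin n → ℂ) × (Fin m → ℂ)) := by
  refine Prod.ext ?_ ?_
  · ext j; simp [Pi.single_apply]
  · simp

lemma single_I_snd (α : Fin m) : ((0, Pi.single α Complex.I) : (Fin n → ℂ) × (Fin m → ℂ)) =
    Complex.I • ((0, Pi.single α 1) : (Fin n → ℂ) × (Fin m → ℂ)) := by
  refine Prod.ext ?_ ?_
  · simp
  · ext j; simp [Pi.single_apply]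

lemma comp_dz (hp : p.proj ∈ c.φ.source) (k : Fin n) :
    c.comp p (c.dz k p) = (Pi.single k 1, 0) :=
  (c.comp_half_mk_coordField hp (single_I_fst k)).1

lemma comp_conj_dz (hp : p.proj ∈ c.φ.source) (k : Fin n) :
    c.comp p (Cx.conj (c.dz k p)) = 0 :=
  (c.comp_half_mk_coordField hp (single_I_fst k)).2

lemma comp_du (hp : p.proj ∈ c.φ.source) (α : Fin m) :
    c.comp p (c.du α p) = (0, Pi.single α 1) :=
  (c.comp_half_mk_coordField hp (single_I_snd α)).1

lemma comp_conj_du (hp : p.proj ∈ c.φ.source) (α : Fin m) :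
    c.comp p (Cx.conj (c.du α p)) = 0 :=
  (c.comp_half_mk_coordField hp (single_I_snd α)).2

lemma mdifferentiableAt_coordField (hp : p.proj ∈ c.φ.source) (w : (Fin n → ℂ) × (Fin m → ℂ)) :
    MDifferentiableAt (RModel n m) (RModel n m).tangent
      (fun q => (⟨q, c.coordField w q⟩ : TangentBundle (RModel n m) (TotalSpace (Fin m → ℂ) E)))
      p := by
  refine MDifferentiableAt.mpullback_vectorField (n := ω) (V := fun _ => w) ?_
    (c.contMDiffAt_coord_real hp) (c.isInvertible_mfderiv_coord hp) le_top
  exact (contMDiffAt_vectorSpace_iff_contDiffAt (n := 1)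
    (V := fun _ : (Fin n → ℂ) × (Fin m → ℂ) => w)|>.2 contDiffAt_const).mdifferentiableAt (by simp)

lemma cxMDiffAt_mk_coordField (hp : p.proj ∈ c.φ.source) (v w : (Fin n → ℂ) × (Fin m → ℂ)) :
    CxMDiffAt (I := RModel n m)
      (fun q => (1 / 2 : ℂ) • Cx.mk (c.coordField v q) (-c.coordField w q)) p := by
  have : CxMDiffAt (I := RModel n m)
      (fun q => Cx.mk (c.coordField v q) (-c.coordField w q)) p := by
    refine ⟨?_, ?_⟩
    · simpa using c.mdifferentiableAt_coordField hp v
    · simp only [Cx.im_mk]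
      exact mdifferentiableAt_neg_section (c.mdifferentiableAt_coordField hp w)
  exact this.smul (f := fun _ => (1 / 2 : ℂ)) mdifferentiableAt_const

lemma cxMDiffAt_dz (hp : p.proj ∈ c.φ.source) (k : Fin n) :
    CxMDiffAt (I := RModel n m) (c.dz k) p :=
  c.cxMDiffAt_mk_coordField hp _ _

lemma cxMDiffAt_du (hp : p.proj ∈ c.φ.source) (α : Fin m) :
    CxMDiffAt (I := RModel n m) (c.du α) p :=
  c.cxMDiffAt_mk_coordField hp _ _

lemma sum_smul_dz_comp (hp : p.proj ∈ c.φ.source) (a : Fin n → ℂ) (b : Fin m → ℂ) :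
    c.comp p (∑ k, a k • c.dz k p - ∑ β, b β • c.du β p) = (a, -b) := by
  simp only [map_sub, map_sum, map_smul, c.comp_dz hp, c.comp_du hp]
  refine Prod.ext ?_ ?_
  · ext j; simp [Prod.fst_sum, Finset.sum_apply, Pi.single_apply]
  · ext j; simp [Prod.snd_sum, Finset.sum_apply, Pi.single_apply]

lemma sum_smul_dz_comp_conj (hp : p.proj ∈ c.φ.source) (a : Fin n → ℂ) (b : Fin m → ℂ) :
    c.comp p (Cx.conj (∑ k, a k • c.dz k p - ∑ β, b β • c.du β p)) = 0 := by
  simp only [map_sub, map_sum, map_smul, Cx.conj_smul, c.comp_conj_dz hp, c.comp_conj_du hp]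
  simp

variable (A : HolLieAlgebroid n m E) (N : Fin m → Fin m → TotalSpace (Fin m → ℂ) E → ℂ)

lemma comp_delta (hp : p.proj ∈ c.φ.source) (α : Fin m) :
    c.comp p (c.delta A N α p) = (fun k => c.rho A α k p.proj, fun β => -N α β p) :=
  c.sum_smul_dz_comp hp _ _

lemma comp_conj_delta (hp : p.proj ∈ c.φ.source) (α : Fin m) :
    c.comp p (Cx.conj (c.delta A N α p)) = 0 :=
  c.sum_smul_dz_comp_conj hp _ _

lemma X_fst (α : Fin m) (p : TotalSpace (Fin m → ℂ) E) :
    (c.X A N α p).1 = Cx.hol (c.e α p.proj) := by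
  simp [X, Z, V, Prod.fst_sum]

lemma X_snd (α : Fin m) (p : TotalSpace (Fin m → ℂ) E) :
    (c.X A N α p).2 = c.delta A N α p := by
  simp [X, Z, V, delta, Prod.snd_sum]

/-- `ρ^k_α` is a composite of holomorphic maps: the section `e_α`, the anchor, the tangent map of
the chart, and the projection to the `k`-th fibre coordinate. -/
lemma contMDiffAt_rho {x : M} (hx : x ∈ c.φ.source) (α : Fin m) (k : Fin n) :
    ContMDiffAt 𝓘(ℂ, Fin n → ℂ) 𝓘(ℂ, ℂ) ω (c.rho A α k) x := by
  have h1 : ContMDiffAt 𝓘(ℂ, Fin n → ℂ) 𝓘(ℂ, Fin n → ℂ).tangent ω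
      (fun y => (⟨y, A.anchor y (c.e α y)⟩ : TangentBundle 𝓘(ℂ, Fin n → ℂ) M)) x :=
    A.anchor_hol.contMDiffAt.comp x (c.isFrame.contMDiffAt c.φ.open_source hx α)
  have h2 := (contMDiffOn_of_mem_maximalAtlas c.φ_mem).contMDiffOn_tangentMapWithin (m := ω)
    le_top c.φ.open_source.uniqueMDiffOn
  have hmem : (TotalSpace.proj : TangentBundle 𝓘(ℂ, Fin n → ℂ) M → M) ⁻¹' c.φ.source ∈
      nhds (⟨x, A.anchor x (c.e α x)⟩ : TangentBundle 𝓘(ℂ, Fin n → ℂ) M) :=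
    (FiberBundle.continuous_proj (Fin n → ℂ) (TangentSpace 𝓘(ℂ, Fin n → ℂ))).continuousAt
      (c.φ.open_source.mem_nhds hx)
  have h3 := (h2.contMDiffAt hmem).comp x h1
  have h4 := (contMDiff_snd_tangentBundle_modelSpace (Fin n → ℂ) 𝓘(ℂ, Fin n → ℂ)
    (n := ω)).contMDiffAt.comp x h3
  have h5 := (ContinuousLinearMap.proj (R := ℂ) (φ := fun _ : Fin n => ℂ)
    k).contDiff.contDiffAt.contMDiffAt (n := ω).comp x h4
  refine h5.congr_of_eventuallyEq ?_
  filter_upwards [c.φ.open_source.mem_nhds hx] with y hy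
  simp only [rho, Function.comp, tangentMapWithin]
  rw [mfderivWithin_of_isOpen c.φ.open_source hy]
  rfl

end BundleChart

/-! ### Membership in the prolongation, and derivatives of functions pulled back from `M` -/

lemma Cx.re_baseChange {V W : Type*} [AddCommGroup V] [Module ℝ V] [AddCommGroup W] [Module ℝ W]
    (f : V →ₗ[ℝ] W) (X : Cx V) : Cx.re (f.baseChange ℂ X) = f (Cx.re X) := by
  induction X using TensorProduct.induction_on with
  | zero => simp
  | tmul d v => simp
  | add x y hx hy => simp only [map_add, hx, hy]

lemma Cx.im_baseChange {V W : Type*} [AddCommGroup V] [Module ℝ V] [AddCommGroup W] [Module ℝ W]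
    (f : V →ₗ[ℝ] W) (X : Cx V) : Cx.im (f.baseChange ℂ X) = f (Cx.im X) := by
  induction X using TensorProduct.induction_on with
  | zero => simp
  | tmul d v => simp
  | add x y hx hy => simp only [map_add, hx, hy]

/-- The differential of the projection `E → M`, as a real linear map. -/
noncomputable def dproj (p : TotalSpace (Fin m → ℂ) E) : RTangent (n := n) p →L[ℝ] (Fin n → ℂ) :=
  mfderiv (RModel n m) 𝓘(ℝ, Fin n → ℂ) (TotalSpace.proj : TotalSpace (Fin m → ℂ) E → M) p

lemma mem_prolongation_iff (A : HolLieAlgebroid n m E) {p : TotalSpace (Fin m → ℂ) E}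
    {x : Ambient (n := n) p} :
    x ∈ prolongation A p ↔ A.anchor p.proj (Cx.re x.1) = dproj p (Cx.re x.2) ∧
      A.anchor p.proj (Cx.im x.1) = dproj p (Cx.im x.2) := by
  rw [prolongation, LinearMap.mem_eqLocus]
  simp only [LinearMap.comp_apply, LinearMap.fst_apply, LinearMap.snd_apply]
  constructor
  · intro h
    refine ⟨?_, ?_⟩
    · have := congrArg Cx.re h
      rw [Cx.re_baseChange, Cx.re_baseChange] at this
      exact this
    · have := congrArg Cx.im h
      rw [Cx.im_baseChange, Cx.im_baseChange] at this
      exact this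
  · rintro ⟨h1, h2⟩
    refine Cx.ext ?_ ?_
    · rw [Cx.re_baseChange, Cx.re_baseChange]; exact h1
    · rw [Cx.im_baseChange, Cx.im_baseChange]; exact h2

lemma conjA_mem_prolongation (A : HolLieAlgebroid n m E) {p : TotalSpace (Fin m → ℂ) E}
    {x : Ambient (n := n) p} (hx : x ∈ prolongation A p) : conjA x ∈ prolongation A p := by
  rw [mem_prolongation_iff] at hx ⊢
  refine ⟨by simpa [conjA] using! hx.1, ?_⟩
  simp only [conjA, Cx.im_conj, map_neg]
  exact congrArg Neg.neg hx.2

lemma mdifferentiableAt_proj_real (p : TotalSpace (Fin m → ℂ) E) :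
    MDifferentiableAt (RModel n m) 𝓘(ℝ, Fin n → ℂ)
      (TotalSpace.proj : TotalSpace (Fin m → ℂ) E → M) p :=
  (contMDiffAt_real (n := 1) cmodel_toPartialEquiv (modelSelf_toPartialEquiv _)
    (contMDiffAt_proj (IB := 𝓘(ℂ, Fin n → ℂ)) E)).mdifferentiableAt (by simp)

/-- The bridge between the real calculus on `E` and the complex calculus on `M`: the chain rule,
with the complex derivative of `f` regarded as a real one. -/
lemma mvfderiv_comp_proj {F : Type*} [NormedAddCommGroup F] [NormedSpace ℂ F] [NormedSpace ℝ F]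
    [IsScalarTower ℝ ℂ F] {f : M → F} {p : TotalSpace (Fin m → ℂ) E}
    (hf : MDifferentiableAt 𝓘(ℂ, Fin n → ℂ) 𝓘(ℂ, F) f p.proj) (v : RTangent (n := n) p) :
    mvfderiv (RModel n m) (fun q : TotalSpace (Fin m → ℂ) E => f q.proj) p v =
      mvfderiv 𝓘(ℂ, Fin n → ℂ) f p.proj (dproj p v) := by
  have hr := hasMFDerivAt_real (modelSelf_toPartialEquiv (Fin n → ℂ)) (modelSelf_toPartialEquiv F)
    (f' := mfderiv 𝓘(ℂ, Fin n → ℂ) 𝓘(ℂ, F) f p.proj) hf.hasMFDerivAt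
  have := (hr.comp p (mdifferentiableAt_proj_real p).hasMFDerivAt).mfderiv
  change (mfderiv (RModel n m) 𝓘(ℝ, F) (f ∘ TotalSpace.proj) p : _ → F) v = _
  rw [this]
  rfl

lemma holDeriv_eq_mvfderiv (f : M → ℂ) (x : M) (v : TangentSpace 𝓘(ℂ, Fin n → ℂ) x) :
    holDeriv n f x v = mvfderiv 𝓘(ℂ, Fin n → ℂ) f x v := rfl

/-- The derivative of a holomorphic function on `M` along an element of the prolongation. -/
lemma cxDeriv_comp_proj (A : HolLieAlgebroid n m E) {p : TotalSpace (Fin m → ℂ) E}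
    {x : Ambient (n := n) p} (hx : x ∈ prolongation A p) {f : M → ℂ}
    (hf : MDifferentiableAt 𝓘(ℂ, Fin n → ℂ) 𝓘(ℂ, ℂ) f p.proj) :
    cxDeriv (RModel n m) (fun q : TotalSpace (Fin m → ℂ) E => f q.proj) p x.2 =
      Cx.coeff ((mvfderiv 𝓘(ℂ, Fin n → ℂ) f p.proj).toLinearMap ∘ₗ A.anchor p.proj) x.1 := by
  rw [mem_prolongation_iff] at hx
  rw [cxDeriv_apply, mvfderiv_comp_proj hf, mvfderiv_comp_proj hf, ← hx.1, ← hx.2]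
  rfl

namespace BundleChart

variable (c : BundleChart n m E) {p : TotalSpace (Fin m → ℂ) E}

lemma mdifferentiable_chart : c.φ.MDifferentiable 𝓘(ℂ, Fin n → ℂ) 𝓘(ℂ, Fin n → ℂ) :=
  ⟨(contMDiffOn_of_mem_maximalAtlas c.φ_mem).mdifferentiableOn (by simp),
    (contMDiffOn_symm_of_mem_maximalAtlas c.φ_mem).mdifferentiableOn (by simp)⟩

lemma mvfderiv_coord_fst (hp : p.proj ∈ c.φ.source) (v : RTangent (n := n) p) :
    (mvfderiv (RModel n m) c.coord p v).1 =
      mvfderiv 𝓘(ℂ, Fin n → ℂ) c.φ p.proj (dproj p v) := by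
  rw [← mvfderiv_comp_proj (c.mdifferentiable_chart.mdifferentiableAt hp)]
  exact (mvfderiv_clm_comp (ContinuousLinearMap.fst ℝ (Fin n → ℂ) (Fin m → ℂ))
    ((c.contMDiffAt_coord_real hp).mdifferentiableAt (by simp)) v).symm

/-- The differential of the chart is injective, so `ρ_ℂ(a) = π_*(X)` can be tested on the
coordinates `z`. The vanishing condition says that `X` has type `(1,0)`, as `Cx.hol a` does. -/
lemma mem_prolongation_of_comp (A : HolLieAlgebroid n m E) (hp : p.proj ∈ c.φ.source)
    {a : E p.proj} {X : Cx (RTangent (n := n) p)}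
    (h : (c.comp p X).1 = mvfderiv 𝓘(ℂ, Fin n → ℂ) c.φ p.proj (A.anchor p.proj a))
    (h' : c.comp p (Cx.conj X) = 0) : ((Cx.hol a, X) : Ambient (n := n) p) ∈ prolongation A p := by
  have hinj : Function.Injective (mvfderiv 𝓘(ℂ, Fin n → ℂ) c.φ p.proj) :=
    c.mdifferentiable_chart.mfderiv_injective hp
  set L : E p.proj →ₗ[ℂ] (Fin n → ℂ) :=
    (mvfderiv 𝓘(ℂ, Fin n → ℂ) c.φ p.proj).toLinearMap ∘ₗ A.anchor p.proj with hL
  have hr : ∀ (r : ℝ) (v : E p.proj), L (r • v) = (r : ℂ) • L v := by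
    intro r v; rw [← Complex.coe_smul, map_smul]
  rw [mem_prolongation_iff]
  refine ⟨hinj ?_, hinj ?_⟩
  · refine Eq.trans ?_ (c.mvfderiv_coord_fst hp _)
    rw [c.coord_re, h', add_zero, Prod.smul_fst, h]
    change L (Cx.re (Cx.hol a)) = (1 / 2 : ℂ) • L a
    rw [Cx.re_hol, hr]; norm_num
  · refine Eq.trans ?_ (c.mvfderiv_coord_fst hp _)
    rw [c.coord_im, h', sub_zero, Prod.smul_fst, h]
    change L (Cx.im (Cx.hol a)) = (-Complex.I / 2 : ℂ) • L a
    rw [Cx.im_hol, map_neg, hr, map_smul, smul_smul, ← neg_smul]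
    congr 1; push_cast; ring

variable (A : HolLieAlgebroid n m E) (N : Fin m → Fin m → TotalSpace (Fin m → ℂ) E → ℂ)

lemma X_mem_prolongation (hp : p.proj ∈ c.φ.source) (α : Fin m) :
    c.X A N α p ∈ prolongation A p := by
  have : c.X A N α p = (Cx.hol (c.e α p.proj), c.delta A N α p) :=
    Prod.ext (c.X_fst A N α p) (c.X_snd A N α p)
  rw [this]
  refine c.mem_prolongation_of_comp A hp ?_ (c.comp_conj_delta A N hp α)
  rw [c.comp_delta A N hp]
  rfl

lemma V_mem_prolongation (hp : p.proj ∈ c.φ.source) (α : Fin m) :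
    c.V α p ∈ prolongation A p := by
  have : c.V α p = (Cx.hol (0 : E p.proj), c.du α p) := by rw [Cx.hol_zero]; rfl
  rw [this]
  refine c.mem_prolongation_of_comp A hp ?_ (c.comp_conj_du hp α)
  rw [c.comp_du hp, map_zero]
  exact (map_zero (mvfderiv 𝓘(ℂ, Fin n → ℂ) c.φ p.proj)).symm

lemma cxMDiffAt_delta (hp : p.proj ∈ c.φ.source)
    (hN : ∀ α β, MDifferentiableAt (RModel n m) 𝓘(ℝ, ℂ) (N α β) p) (α : Fin m) :
    CxMDiffAt (I := RModel n m) (c.delta A N α) p := by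
  have hrho : ∀ k, MDifferentiableAt (RModel n m) 𝓘(ℝ, ℂ)
      (fun q : TotalSpace (Fin m → ℂ) E => c.rho A α k q.proj) p := fun k =>
    ((contMDiffAt_real (modelSelf_toPartialEquiv _) (modelSelf_toPartialEquiv _)
      (c.contMDiffAt_rho A hp α k)).mdifferentiableAt (by simp)).comp p
      (mdifferentiableAt_proj_real p)
  exact (CxMDiffAt.sum fun k _ => (c.cxMDiffAt_dz hp k).smul (hrho k)).sub
    (CxMDiffAt.sum fun β _ => (c.cxMDiffAt_du hp β).smul (hN α β))

end BundleChart

/-! ### Consequences of the Lie algebroid axioms -/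

lemma IsHolSection.add {s t : ∀ x, E x} {U : Set M} (hs : IsHolSection n m E s U)
    (ht : IsHolSection n m E t U) : IsHolSection n m E (s + t) U :=
  ContMDiffOn.add_section hs ht

lemma IsHolSection.smul {f : M → ℂ} {s : ∀ x, E x} {U : Set M}
    (hf : ContMDiffOn 𝓘(ℂ, Fin n → ℂ) 𝓘(ℂ, ℂ) ω f U) (hs : IsHolSection n m E s U) :
    IsHolSection n m E (fun x => f x • s x) U :=
  ContMDiffOn.smul_section hf hs

lemma IsHolSection.sum {ι : Type*} {S : Finset ι} {s : ι → ∀ x, E x} {U : Set M}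
    (hs : ∀ i ∈ S, IsHolSection n m E (s i) U) :
    IsHolSection n m E (fun x => ∑ i ∈ S, s i x) U :=
  ContMDiffOn.sum_section hs

lemma IsHolSection.zero {U : Set M} : IsHolSection n m E (fun _ => 0) U := by
  simpa using IsHolSection.sum (n := n) (S := (∅ : Finset Unit)) (s := fun _ => fun x => (0 : E x))
    (U := U) (by simp)

lemma IsHolSection.congr {s t : ∀ x, E x} {U : Set M} (hs : IsHolSection n m E s U)
    (h : ∀ x ∈ U, t x = s x) : IsHolSection n m E t U :=
  ContMDiffOn.congr hs fun x hx => by rw [h x hx]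

namespace HolLieAlgebroid

variable (A : HolLieAlgebroid n m E) {U : Set M} {s t r : ∀ x, E x}

lemma bracket_zero_right (hU : IsOpen U) (hs : IsHolSection n m E s U) {x : M} (hx : x ∈ U) :
    A.bracket s (fun _ => 0) x = 0 := by
  have := A.bracket_add U hU s (fun _ => 0) (fun _ => 0) hs IsHolSection.zero IsHolSection.zero x hx
  rwa [show ((fun _ => 0 : ∀ x, E x) + fun _ => 0) = fun _ => 0 by ext; simp, left_eq_add] at this

lemma bracket_sum_right (hU : IsOpen U) (hs : IsHolSection n m E s U) {ι : Type*} (S : Finset ι)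
    {b : ι → ∀ x, E x} (hb : ∀ i, IsHolSection n m E (b i) U) {x : M} (hx : x ∈ U) :
    A.bracket s (fun y => ∑ i ∈ S, b i y) x = ∑ i ∈ S, A.bracket s (b i) x := by
  classical
  induction S using Finset.induction_on with
  | empty => simpa using A.bracket_zero_right hU hs hx
  | insert i S hi ih =>
    have : (fun y => ∑ j ∈ insert i S, b j y) = b i + fun y => ∑ j ∈ S, b j y := by
      ext y; simp [Finset.sum_insert hi]
    rw [this, A.bracket_add U hU _ _ _ hs (hb i) (IsHolSection.sum fun j _ => hb j) x hx, ih,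
      Finset.sum_insert hi]

lemma bracket_sum_smul_right (hU : IsOpen U) (hs : IsHolSection n m E s U) {ι : Type*} [Fintype ι]
    {b : ι → ∀ x, E x} (hb : ∀ i, IsHolSection n m E (b i) U) {f : ι → M → ℂ}
    (hf : ∀ i, ContMDiffOn 𝓘(ℂ, Fin n → ℂ) 𝓘(ℂ, ℂ) ω (f i) U)
    (ht : IsHolSection n m E t U) (htf : ∀ y ∈ U, t y = ∑ i, f i y • b i y) {x : M} (hx : x ∈ U) :
    A.bracket s t x = ∑ i, (f i x • A.bracket s (b i) x +
      holDeriv n (f i) x (A.anchor x (s x)) • b i x) := by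
  rw [A.bracket_congr U hU s s t (fun y => ∑ i, f i y • b i y) hs ht (fun _ _ => rfl) htf x hx,
    A.bracket_sum_right hU hs Finset.univ (fun i => IsHolSection.smul (hf i) (hb i)) hx]
  exact Finset.sum_congr rfl fun i _ => A.bracket_leibniz U hU (f i) s (b i) (hf i) hs (hb i) x hx

/-- The bracket in terms of the coefficients of the sections in a holomorphic frame. -/
lemma bracket_eq_sum (hU : IsOpen U) {ι : Type*} [Fintype ι]
    {b : ι → ∀ x, E x} (hb : ∀ i, IsHolSection n m E (b i) U) {f g : ι → M → ℂ}
    (hf : ∀ i, ContMDiffOn 𝓘(ℂ, Fin n → ℂ) 𝓘(ℂ, ℂ) ω (f i) U)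
    (hg : ∀ i, ContMDiffOn 𝓘(ℂ, Fin n → ℂ) 𝓘(ℂ, ℂ) ω (g i) U)
    (hs : IsHolSection n m E s U) (hsf : ∀ y ∈ U, s y = ∑ i, f i y • b i y)
    (ht : IsHolSection n m E t U) (htg : ∀ y ∈ U, t y = ∑ i, g i y • b i y) {x : M} (hx : x ∈ U) :
    A.bracket s t x = ∑ i, ∑ j, (f i x * g j x) • A.bracket (b i) (b j) x +
      ∑ i, (holDeriv n (g i) x (A.anchor x (s x)) - holDeriv n (f i) x (A.anchor x (t x))) •
        b i x := by
  have h1 : ∀ j, A.bracket s (b j) x = ∑ i, (f i x • A.bracket (b i) (b j) x -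
      holDeriv n (f i) x (A.anchor x (b j x)) • b i x) := by
    intro j
    -- The Leibniz rule is available in the second slot only; skew symmetry, used before and after,
    -- carries it to the first.
    rw [A.bracket_skew U hU s (b j) hs (hb j) x hx,
      A.bracket_sum_smul_right hU (hb j) hb hf hs hsf hx, ← Finset.sum_neg_distrib]
    refine Finset.sum_congr rfl fun i _ => ?_
    rw [A.bracket_skew U hU (b j) (b i) (hb j) (hb i) x hx]
    module
  have h2 : ∀ i, holDeriv n (f i) x (A.anchor x (t x)) =
      ∑ j, g j x * holDeriv n (f i) x (A.anchor x (b j x)) := by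
    intro i
    rw [htg x hx]
    simp only [holDeriv_eq_mvfderiv, map_sum, map_smul, smul_eq_mul]
  rw [A.bracket_sum_smul_right hU hs hb hg ht htg hx]
  simp only [h1, h2, sub_smul, Finset.sum_smul, Finset.smul_sum, smul_sub, Finset.sum_sub_distrib,
    Finset.sum_add_distrib, smul_smul]
  rw [Finset.sum_comm (f := fun j i => (g j x * f i x) • A.bracket (b i) (b j) x),
    Finset.sum_comm (f := fun j i => (g j x * holDeriv n (f i) x (A.anchor x (b j x))) • b i x)]
  simp only [mul_comm (g _ x) (f _ x)]
  abel

/-- The anchor is a homomorphism of Lie algebras, a consequence of the Jacobi identity and the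
Leibniz rule. -/
lemma holDeriv_anchor_bracket (hU : IsOpen U) (hs : IsHolSection n m E s U)
    (ht : IsHolSection n m E t U) (hr : IsHolSection n m E r U) {f g h : M → ℂ}
    (hf : ContMDiffOn 𝓘(ℂ, Fin n → ℂ) 𝓘(ℂ, ℂ) ω f U)
    (hg : ContMDiffOn 𝓘(ℂ, Fin n → ℂ) 𝓘(ℂ, ℂ) ω g U)
    (hh : ContMDiffOn 𝓘(ℂ, Fin n → ℂ) 𝓘(ℂ, ℂ) ω h U)
    (hgs : ∀ y ∈ U, g y = holDeriv n f y (A.anchor y (s y)))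
    (hht : ∀ y ∈ U, h y = holDeriv n f y (A.anchor y (t y))) {x : M} (hx : x ∈ U) :
    holDeriv n f x (A.anchor x (A.bracket s t x)) • r x =
      (holDeriv n h x (A.anchor x (s x)) - holDeriv n g x (A.anchor x (t x))) • r x := by
  have hfr := IsHolSection.smul hf hr
  have expand : ∀ {s t : ∀ x, E x} {g h : M → ℂ}, IsHolSection n m E s U → IsHolSection n m E t U →
      ContMDiffOn 𝓘(ℂ, Fin n → ℂ) 𝓘(ℂ, ℂ) ω h U →
      (∀ y ∈ U, g y = holDeriv n f y (A.anchor y (s y))) →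
      (∀ y ∈ U, h y = holDeriv n f y (A.anchor y (t y))) →
      A.bracket s (A.bracket t (fun y => f y • r y)) x =
        f x • A.bracket s (A.bracket t r) x + g x • A.bracket t r x +
        (h x • A.bracket s r x + holDeriv n h x (A.anchor x (s x)) • r x) := by
    intro s t g h hs ht hh hgs hht
    have htr := A.bracket_hol U hU t r ht hr
    have h1 : ∀ y ∈ U, A.bracket t (fun y => f y • r y) y =
        ((fun y => f y • A.bracket t r y) + fun y => h y • r y) y := by
      intro y hy
      rw [A.bracket_leibniz U hU f t r hf ht hr y hy, ← hht y hy]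
      rfl
    -- The expansion of the inner bracket holds only on `U`, so locality of the bracket is needed to
    -- substitute it into the outer one.
    rw [A.bracket_congr U hU s s _ _ hs (A.bracket_hol U hU _ _ ht hfr) (fun _ _ => rfl) h1 x hx,
      A.bracket_add U hU s _ _ hs (IsHolSection.smul hf htr) (IsHolSection.smul hh hr) x hx,
      A.bracket_leibniz U hU f s _ hf hs htr x hx, A.bracket_leibniz U hU h s r hh hs hr x hx,
      ← hgs x hx]
  -- In the Jacobi identity for `(s, t, f r)` the terms with first derivatives of `f` along `s` or
  -- `t` occur on both sides, and `f` times the identity for `(s, t, r)` removes the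
  -- undifferentiated ones.
  have hJ := A.bracket_jacobi U hU s t (fun y => f y • r y) hs ht hfr x hx
  have hJ' := A.bracket_jacobi U hU s t r hs ht hr x hx
  rw [expand hs ht hh hgs hht, expand ht hs hg hht hgs,
    A.bracket_leibniz U hU f _ r hf (A.bracket_hol U hU s t hs ht) hr x hx, hJ'] at hJ
  rw [sub_smul]
  linear_combination (norm := module) (-1 : ℂ) • hJ

end HolLieAlgebroid

/-! ### The structure equation of the anchor in coordinates -/

namespace BundleChart

variable (c : BundleChart n m E) (A : HolLieAlgebroid n m E)

lemma isHolSection_e (α : Fin m) : IsHolSection n m E (c.e α) c.φ.source :=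
  c.isFrame.contMDiffOn α

lemma e_ne_zero {x : M} (hx : x ∈ c.φ.source) (α : Fin m) : c.e α x ≠ 0 :=
  (c.isFrame.linearIndependent hx).ne_zero α

lemma bracket_e {x : M} (hx : x ∈ c.φ.source) (α β : Fin m) :
    A.bracket (c.e α) (c.e β) x = ∑ γ, c.struct A α β γ x • c.e γ x :=
  c.isFrame.coeff_sum_eq (A.bracket (c.e α) (c.e β)) hx

lemma mvfderiv_chart_coordinate {x : M} (hx : x ∈ c.φ.source) (k : Fin n)
    (v : TangentSpace 𝓘(ℂ, Fin n → ℂ) x) :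
    holDeriv n (fun y => c.φ y k) x v = mvfderiv 𝓘(ℂ, Fin n → ℂ) c.φ x v k := by
  have hφ := c.mdifferentiable_chart.mdifferentiableAt hx
  have := mfderiv_comp x ((ContinuousLinearMap.proj (R := ℂ) (φ := fun _ : Fin n => ℂ)
    k).differentiableAt.mdifferentiableAt) hφ
  rw [mfderiv_eq_fderiv, ContinuousLinearMap.fderiv] at this
  exact DFunLike.congr_fun this v

/-- The structure equation `ρ([e_α, e_β]) = [ρ(e_α), ρ(e_β)]` in coordinates. -/
lemma sum_struct_mul_rho {x : M} (hx : x ∈ c.φ.source) (α β : Fin m) (k : Fin n) :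
    ∑ γ, c.struct A α β γ x * c.rho A γ k x =
      holDeriv n (c.rho A β k) x (A.anchor x (c.e α x)) -
        holDeriv n (c.rho A α k) x (A.anchor x (c.e β x)) := by
  have hf : ContMDiffOn 𝓘(ℂ, Fin n → ℂ) 𝓘(ℂ, ℂ) ω (fun y => c.φ y k) c.φ.source :=
    (ContinuousLinearMap.proj (R := ℂ) (φ := fun _ : Fin n => ℂ)
      k).contDiff.contMDiff.comp_contMDiffOn (contMDiffOn_of_mem_maximalAtlas c.φ_mem)
  have hrho : ∀ γ, ContMDiffOn 𝓘(ℂ, Fin n → ℂ) 𝓘(ℂ, ℂ) ω (c.rho A γ k) c.φ.source :=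
    fun γ y hy => (c.contMDiffAt_rho A hy γ k).contMDiffWithinAt
  have hd : ∀ γ, ∀ y ∈ c.φ.source, c.rho A γ k y =
      holDeriv n (fun y => c.φ y k) y (A.anchor y (c.e γ y)) := fun γ y hy =>
    (c.mvfderiv_chart_coordinate hy k _).symm
  -- Here `f` is the coordinate `z^k`, whose derivative along `ρ(e_γ)` is `ρ^k_γ`. The auxiliary
  -- section `r` only has to be nonzero at `x` so that it can be cancelled; `e_α` serves.
  have key := A.holDeriv_anchor_bracket c.φ.open_source (c.isHolSection_e α) (c.isHolSection_e β)
    (c.isHolSection_e α) hf (hrho α) (hrho β) (hd α) (hd β) hx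
  rw [← smul_left_injective ℂ (c.e_ne_zero hx α) key, c.bracket_e A hx]
  simp only [hd _ x hx, holDeriv_eq_mvfderiv, map_sum, map_smul, smul_eq_mul]

end BundleChart

/-! ### The first component of the prolongation bracket -/

lemma isHolSection_refFrame (x₀ : M) (γ : Fin m) : IsHolSection n m E (refFrame x₀ γ)
    (trivializationAt (Fin m → ℂ) E x₀).baseSet :=
  (trivializationAt (Fin m → ℂ) E x₀).contMDiffOn_localFrame_baseSet ω _ γ

lemma contMDiffOn_refCoeff (x₀ : M) (γ : Fin m) {s : ∀ x, E x} {U : Set M} (hU : IsOpen U)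
    (hU' : U ⊆ (trivializationAt (Fin m → ℂ) E x₀).baseSet) (hs : IsHolSection n m E s U) :
    ContMDiffOn 𝓘(ℂ, Fin n → ℂ) 𝓘(ℂ, ℂ) ω (fun x => refCoeff (n := n) x₀ γ x (s x)) U :=
  contMDiffOn_localFrameCoeff (Pi.basisFun ℂ (Fin m)) hU hU' hs γ

lemma eq_sum_refCoeff (x₀ : M) (s : ∀ x, E x) {x : M}
    (hx : x ∈ (trivializationAt (Fin m → ℂ) E x₀).baseSet) :
    s x = ∑ γ : Fin m, refCoeff (n := n) x₀ γ x (s x) • refFrame x₀ γ x :=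
  Trivialization.eq_sum_localFrameCoeff_smul hx

lemma mdifferentiableAt_refCoeff {s : ∀ x, E x} {U : Set M} (hU : IsOpen U)
    (hs : IsHolSection n m E s U) {x : M} (hx : x ∈ U) (γ : Fin m) :
    MDifferentiableAt 𝓘(ℂ, Fin n → ℂ) 𝓘(ℂ, ℂ) (fun y => refCoeff (n := n) x γ y (s y)) x := by
  have hb := mem_baseSet_trivializationAt (Fin m → ℂ) E x
  have hU' := hU.inter (trivializationAt (Fin m → ℂ) E x).open_baseSet
  exact ((contMDiffOn_refCoeff x γ hU' Set.inter_subset_right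
    (hs.mono Set.inter_subset_left)).contMDiffAt (hU'.mem_nhds ⟨hx, hb⟩)).mdifferentiableAt
    (by simp)

section FirstComponent

variable (A : HolLieAlgebroid n m E) {U : Set M} {s t : ∀ x, E x}
  {σ τ : ∀ p : TotalSpace (Fin m → ℂ) E, Ambient (n := n) p} {p : TotalSpace (Fin m → ℂ) E}

/-- For sections of the prolongation which project to holomorphic sections of `E`, the first
component of the bracket is the bracket of `E`. -/
lemma prolongBracket_fst_of_hol (hU : IsOpen U) (hs : IsHolSection n m E s U)
    (ht : IsHolSection n m E t U) (hp : p.proj ∈ U) (hσ : ∀ q, (σ q).1 = Cx.hol (s q.proj))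
    (hτ : ∀ q, (τ q).1 = Cx.hol (t q.proj)) (hσp : σ p ∈ prolongation A p)
    (hτp : τ p ∈ prolongation A p) :
    (prolongBracket A σ τ p).1 = Cx.hol (A.bracket s t p.proj) := by
  have hb := mem_baseSet_trivializationAt (Fin m → ℂ) E p.proj
  -- The bracket at `p` is defined with the frame of the trivialization at `p.proj`, so everything
  -- takes place on the intersection with its base set.
  have hU' := hU.inter (trivializationAt (Fin m → ℂ) E p.proj).open_baseSet
  have hs' : IsHolSection n m E s (U ∩ (trivializationAt (Fin m → ℂ) E p.proj).baseSet) :=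
    hs.mono Set.inter_subset_left
  have ht' : IsHolSection n m E t (U ∩ (trivializationAt (Fin m → ℂ) E p.proj).baseSet) :=
    ht.mono Set.inter_subset_left
  have h1 : ∀ γ, cderiv (σ p).2 (fun q => refCoeff (n := n) p.proj γ q.proj (t q.proj)) =
      holDeriv n (fun y => refCoeff (n := n) p.proj γ y (t y)) p.proj
        (A.anchor p.proj (s p.proj)) := fun γ => by
    refine (cxDeriv_comp_proj A hσp (mdifferentiableAt_refCoeff hU ht hp γ)).trans ?_
    rw [hσ, Cx.coeff_hol]; rfl
  have h2 : ∀ γ, cderiv (τ p).2 (fun q => refCoeff (n := n) p.proj γ q.proj (s q.proj)) =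
      holDeriv n (fun y => refCoeff (n := n) p.proj γ y (s y)) p.proj
        (A.anchor p.proj (t p.proj)) := fun γ => by
    refine (cxDeriv_comp_proj A hτp (mdifferentiableAt_refCoeff hU hs hp γ)).trans ?_
    rw [hτ, Cx.coeff_hol]; rfl
  simp only [prolongBracket, hσ, hτ, Cx.coeff_hol, Cx.coeffBar_hol, h1, h2]
  rw [A.bracket_eq_sum hU'
    (fun γ => (isHolSection_refFrame p.proj γ).mono Set.inter_subset_right)
    (fun γ => contMDiffOn_refCoeff p.proj γ hU' Set.inter_subset_right hs')
    (fun γ => contMDiffOn_refCoeff p.proj γ hU' Set.inter_subset_right ht') hs'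
    (fun y hy => eq_sum_refCoeff p.proj s hy.2) ht' (fun y hy => eq_sum_refCoeff p.proj t hy.2)
    ⟨hp, hb⟩]
  simp only [Cx.hol_add, Cx.hol_sum, Cx.hol_smul, cderiv_eq_cxDeriv, cxDeriv_const, mul_zero,
    sub_zero, zero_smul, Finset.sum_const_zero, add_zero]

/-- The first component of the bracket of a section of type `(1,0)` and one of type `(0,1)`
vanishes. -/
lemma prolongBracket_fst_of_hol_conj (hU : IsOpen U) (hs : IsHolSection n m E s U)
    (ht : IsHolSection n m E t U) (hp : p.proj ∈ U) (hσ : ∀ q, (σ q).1 = Cx.hol (s q.proj))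
    (hτ : ∀ q, (τ q).1 = Cx.conj (Cx.hol (t q.proj))) (hσp : σ p ∈ prolongation A p)
    (hτp : τ p ∈ prolongation A p) :
    (prolongBracket A σ τ p).1 = 0 := by
  -- Differentiating a conjugate function along `X` is conjugate to differentiating the function
  -- along `X̄`. The conjugate of `σ p` again lies in the prolongation, with first component of type
  -- `(0,1)`, which complex linear functionals kill.
  have h1 : ∀ γ, cderiv (σ p).2
      (fun q => starRingEnd ℂ (refCoeff (n := n) p.proj γ q.proj (t q.proj))) = 0 := fun γ => by
    rw [cderiv_eq_cxDeriv, cxDeriv_star]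
    have := cxDeriv_comp_proj A (conjA_mem_prolongation A hσp)
      (mdifferentiableAt_refCoeff hU ht hp γ)
    simp only [conjA, hσ, Cx.coeff_conj_hol] at this
    rw [this, map_zero]
  have h2 : ∀ γ, cderiv (τ p).2 (fun q => refCoeff (n := n) p.proj γ q.proj (s q.proj)) = 0 :=
    fun γ => by
      refine (cxDeriv_comp_proj A hτp (mdifferentiableAt_refCoeff hU hs hp γ)).trans ?_
      rw [hτ, Cx.coeff_conj_hol]
  simp only [prolongBracket, hσ, hτ, Cx.coeff_hol, Cx.coeffBar_hol, Cx.coeff_conj_hol,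
    Cx.coeffBar_conj, h1, h2]
  simp only [cderiv_eq_cxDeriv, cxDeriv_const, mul_zero, zero_mul,
    sub_zero, zero_smul, Finset.sum_const_zero, add_zero]

end FirstComponent

/-! ### Compatibility of the brackets with conjugation -/

section Conjugation

variable {X Y : ∀ p : TotalSpace (Fin m → ℂ) E, Cx (RTangent (n := n) p)}
  {p : TotalSpace (Fin m → ℂ) E}

lemma mlieBracket_neg_right {V W : ∀ p : TotalSpace (Fin m → ℂ) E, RTangent (n := n) p}
    (hW : MDifferentiableAt (RModel n m) (RModel n m).tangent
      (fun q => (⟨q, W q⟩ : TangentBundle (RModel n m) (TotalSpace (Fin m → ℂ) E))) p) :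
    VectorField.mlieBracket (RModel n m) V (fun q => -W q) p =
      -VectorField.mlieBracket (RModel n m) V W p := by
  have := VectorField.mlieBracket_const_smul_right (c := (-1 : ℝ)) (V := V) hW
  rw [neg_one_smul] at this
  exact this.trans (neg_one_smul ℝ _)

lemma mlieBracket_neg_left {V W : ∀ p : TotalSpace (Fin m → ℂ) E, RTangent (n := n) p}
    (hV : MDifferentiableAt (RModel n m) (RModel n m).tangent
      (fun q => (⟨q, V q⟩ : TangentBundle (RModel n m) (TotalSpace (Fin m → ℂ) E))) p) :
    VectorField.mlieBracket (RModel n m) (fun q => -V q) W p =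
      -VectorField.mlieBracket (RModel n m) V W p := by
  rw [VectorField.mlieBracket_swap_apply, mlieBracket_neg_right hV,
    ← VectorField.mlieBracket_swap_apply (V := V)]

lemma cbracket_conj (hX : CxMDiffAt (I := RModel n m) X p) (hY : CxMDiffAt (I := RModel n m) Y p) :
    cbracket (fun q => Cx.conj (X q)) (fun q => Cx.conj (Y q)) p = Cx.conj (cbracket X Y p) := by
  have h2 : VectorField.mlieBracket (RModel n m) (fun q => -Cx.im (X q)) (fun q => -Cx.im (Y q)) p =
      VectorField.mlieBracket (RModel n m) (fun q => Cx.im (X q)) (fun q => Cx.im (Y q)) p := by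
    rw [mlieBracket_neg_left hX.im, mlieBracket_neg_right hY.im, neg_neg]
  simp only [cbracket, Cx.re_conj, Cx.im_conj, Cx.conj_mk, h2]
  rw [mlieBracket_neg_left hX.im, mlieBracket_neg_right hY.im, neg_add]

lemma conjA_add {x y : Ambient (n := n) p} : conjA (x + y) = conjA x + conjA y := by
  simp [conjA]

lemma conjA_sum {ι : Type*} (S : Finset ι) (x : ι → Ambient (n := n) p) :
    conjA (∑ i ∈ S, x i) = ∑ i ∈ S, conjA (x i) := by
  simp [conjA, Prod.ext_iff, Prod.fst_sum, Prod.snd_sum]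

lemma conjA_smul (a : ℂ) (x : Ambient (n := n) p) :
    conjA (a • x) = starRingEnd ℂ a • conjA x := by
  simp [conjA]

/-- The bracket of the prolongation commutes with complex conjugation. -/
lemma prolongBracket_conjA (A : HolLieAlgebroid n m E)
    {σ τ : ∀ p : TotalSpace (Fin m → ℂ) E, Ambient (n := n) p}
    (hσ : CxMDiffAt (I := RModel n m) (fun q => (σ q).2) p)
    (hτ : CxMDiffAt (I := RModel n m) (fun q => (τ q).2) p) :
    prolongBracket A (fun q => conjA (σ q)) (fun q => conjA (τ q)) p =
      conjA (prolongBracket A σ τ p) := by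
  refine Prod.ext ?_ (cbracket_conj hσ hτ)
  -- Conjugation exchanges the holomorphic and antiholomorphic halves of the defining formula.
  simp only [prolongBracket, conjA, Cx.coeff_conj, Cx.coeffBar_conj, cderiv_eq_cxDeriv,
    cxDeriv_star, Cx.conj_conj, map_add, map_sum, Cx.conj_smul, map_mul, map_sub]
  abel

end Conjugation

/-! ### Lie brackets of the fields `δ_α`, `∂̇_α` and their conjugates -/

namespace BundleChart

variable (c : BundleChart n m E) {p : TotalSpace (Fin m → ℂ) E}

lemma contMDiffAt_coord_two (hp : p.proj ∈ c.φ.source) :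
    ContMDiffAt (RModel n m) 𝓘(ℝ, (Fin n → ℂ) × (Fin m → ℂ)) 2 c.coord p :=
  (c.contMDiffAt_coord_real hp).of_le le_top

lemma comp_cbracket (hp : p.proj ∈ c.φ.source)
    {X Y : ∀ p : TotalSpace (Fin m → ℂ) E, Cx (RTangent (n := n) p)}
    (hX : CxMDiffAt (I := RModel n m) X p) (hY : CxMDiffAt (I := RModel n m) Y p) :
    c.comp p (cbracket X Y p) = cxDeriv (RModel n m) (fun q => c.comp q (Y q)) p (X p) -
      cxDeriv (RModel n m) (fun q => c.comp q (X q)) p (Y p) :=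
  cxDeriv_bracket hX hY (c.contMDiffAt_coord_two hp)

lemma comp_conj_cbracket (hp : p.proj ∈ c.φ.source)
    {X Y : ∀ p : TotalSpace (Fin m → ℂ) E, Cx (RTangent (n := n) p)}
    (hX : CxMDiffAt (I := RModel n m) X p) (hY : CxMDiffAt (I := RModel n m) Y p) :
    c.comp p (Cx.conj (cbracket X Y p)) =
      cxDeriv (RModel n m) (fun q => c.comp q (Cx.conj (Y q))) p (Cx.conj (X p)) -
      cxDeriv (RModel n m) (fun q => c.comp q (Cx.conj (X q))) p (Cx.conj (Y p)) := by
  rw [← cbracket_conj hX hY, c.comp_cbracket hp hX.conj hY.conj]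

lemma cxDeriv_eq_zero_of_eventually_const {f : TotalSpace (Fin m → ℂ) E → (Fin n → ℂ) × (Fin m → ℂ)}
    (hp : p.proj ∈ c.φ.source) {a : (Fin n → ℂ) × (Fin m → ℂ)}
    (hf : ∀ q : TotalSpace (Fin m → ℂ) E, q.proj ∈ c.φ.source → f q = a)
    (Z : Cx (RTangent (n := n) p)) : cxDeriv (RModel n m) f p Z = 0 := by
  have : f =ᶠ[nhds p] fun _ => a := by
    filter_upwards [eventually_proj_mem c.φ.open_source hp] with q hq using hf q hq
  rw [cxDeriv_congr this, cxDeriv_const]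

lemma cxDeriv_comp_du (hp : p.proj ∈ c.φ.source) (α : Fin m) (Z : Cx (RTangent (n := n) p)) :
    cxDeriv (RModel n m) (fun q => c.comp q (c.du α q)) p Z = 0 :=
  c.cxDeriv_eq_zero_of_eventually_const hp (fun _ hq => c.comp_du hq α) Z

lemma cxDeriv_comp_conj_du (hp : p.proj ∈ c.φ.source) (α : Fin m) (Z : Cx (RTangent (n := n) p)) :
    cxDeriv (RModel n m) (fun q => c.comp q (Cx.conj (c.du α q))) p Z = 0 :=
  c.cxDeriv_eq_zero_of_eventually_const hp (fun _ hq => c.comp_conj_du hq α) Z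

variable (A : HolLieAlgebroid n m E) (N : Fin m → Fin m → TotalSpace (Fin m → ℂ) E → ℂ)

lemma cxDeriv_comp_conj_delta (hp : p.proj ∈ c.φ.source) (α : Fin m)
    (Z : Cx (RTangent (n := n) p)) :
    cxDeriv (RModel n m) (fun q => c.comp q (Cx.conj (c.delta A N α q))) p Z = 0 :=
  c.cxDeriv_eq_zero_of_eventually_const hp (fun _ hq => c.comp_conj_delta A N hq α) Z

lemma cxDeriv_neg (f : TotalSpace (Fin m → ℂ) E → ℂ) (Z : Cx (RTangent (n := n) p)) :
    cxDeriv (RModel n m) (fun q => -f q) p Z = -cxDeriv (RModel n m) f p Z := by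
  simp only [cxDeriv_apply, mvfderiv_fun_neg, _root_.neg_apply, smul_neg]
  ring

/-- The values of `δ_α` on the coordinates are known on all of `π⁻¹(U)`, an open set, so they may be
differentiated component by component. -/
lemma cxDeriv_comp_delta (hp : p.proj ∈ c.φ.source)
    (hN : ∀ α β, MDifferentiableAt (RModel n m) 𝓘(ℝ, ℂ) (N α β) p) (α : Fin m)
    (Z : Cx (RTangent (n := n) p)) :
    cxDeriv (RModel n m) (fun q => c.comp q (c.delta A N α q)) p Z =
      (fun k => cxDeriv (RModel n m)
        (fun q : TotalSpace (Fin m → ℂ) E => c.rho A α k q.proj) p Z,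
      fun β => -cxDeriv (RModel n m) (N α β) p Z) := by
  have hd := (c.cxMDiffAt_delta A N hp hN α).cxDeriv (c.contMDiffAt_coord_two hp)
  have hev := eventually_proj_mem c.φ.open_source hp
  refine Prod.ext (funext fun k => ?_) (funext fun β => ?_)
  · refine (cxDeriv_clm_comp ((ContinuousLinearMap.proj (R := ℂ)
      (φ := fun _ : Fin n => ℂ) k).comp (ContinuousLinearMap.fst ℂ (Fin n → ℂ) (Fin m → ℂ)))
      hd Z).symm.trans (cxDeriv_congr ?_ Z)
    filter_upwards [hev] with q hq
    exact congrFun (congrArg Prod.fst (c.comp_delta A N hq α)) k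
  · refine (cxDeriv_clm_comp ((ContinuousLinearMap.proj (R := ℂ)
      (φ := fun _ : Fin m => ℂ) β).comp (ContinuousLinearMap.snd ℂ (Fin n → ℂ) (Fin m → ℂ)))
      hd Z).symm.trans ((cxDeriv_congr ?_ Z).trans (cxDeriv_neg _ Z))
    filter_upwards [hev] with q hq
    exact congrFun (congrArg Prod.snd (c.comp_delta A N hq α)) β

lemma cxDeriv_rho_of_mem (hp : p.proj ∈ c.φ.source) (α : Fin m) (k : Fin n)
    {x : Ambient (n := n) p} (hx : x ∈ prolongation A p) :
    cxDeriv (RModel n m) (fun q : TotalSpace (Fin m → ℂ) E => c.rho A α k q.proj) p x.2 =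
      Cx.coeff ((mvfderiv 𝓘(ℂ, Fin n → ℂ) (c.rho A α k) p.proj).toLinearMap ∘ₗ A.anchor p.proj)
        x.1 :=
  cxDeriv_comp_proj A hx ((c.contMDiffAt_rho A hp α k).mdifferentiableAt (by simp))

/-- A function from `M` sees only the projection of `δ_α`, which is `ρ(e_α)` since `𝒳_α` lies in the
prolongation. -/
lemma cxDeriv_rho_delta (hp : p.proj ∈ c.φ.source) (α β : Fin m) (k : Fin n) :
    cxDeriv (RModel n m) (fun q : TotalSpace (Fin m → ℂ) E => c.rho A β k q.proj) p
      (c.delta A N α p) = holDeriv n (c.rho A β k) p.proj (A.anchor p.proj (c.e α p.proj)) := by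
  have := c.cxDeriv_rho_of_mem A hp β k (c.X_mem_prolongation A N hp α)
  rw [c.X_fst, c.X_snd, Cx.coeff_hol] at this
  exact this

lemma cxDeriv_rho_conj_delta (hp : p.proj ∈ c.φ.source) (α β : Fin m) (k : Fin n) :
    cxDeriv (RModel n m) (fun q : TotalSpace (Fin m → ℂ) E => c.rho A β k q.proj) p
      (Cx.conj (c.delta A N α p)) = 0 := by
  have := c.cxDeriv_rho_of_mem A hp β k
    (conjA_mem_prolongation A (c.X_mem_prolongation A N hp α))
  simpa only [conjA, c.X_fst, c.X_snd, Cx.coeff_conj_hol] using this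

lemma cxDeriv_rho_du (hp : p.proj ∈ c.φ.source) (α β : Fin m) (k : Fin n) :
    cxDeriv (RModel n m) (fun q : TotalSpace (Fin m → ℂ) E => c.rho A β k q.proj) p
      (c.du α p) = 0 := by
  have := c.cxDeriv_rho_of_mem A hp β k (c.V_mem_prolongation A hp α)
  simpa [V, Cx.coeff] using this

lemma cxDeriv_rho_conj_du (hp : p.proj ∈ c.φ.source) (α β : Fin m) (k : Fin n) :
    cxDeriv (RModel n m) (fun q : TotalSpace (Fin m → ℂ) E => c.rho A β k q.proj) p
      (Cx.conj (c.du α p)) = 0 := by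
  have := c.cxDeriv_rho_of_mem A hp β k (conjA_mem_prolongation A (c.V_mem_prolongation A hp α))
  simpa [V, Cx.coeff, conjA] using this

lemma comp_sum_du (hp : p.proj ∈ c.φ.source) (a : Fin m → ℂ) :
    c.comp p (∑ γ, a γ • c.du γ p) = (0, a) := by
  simp only [map_sum, map_smul, c.comp_du hp]
  refine Prod.ext ?_ ?_
  · simp [Prod.fst_sum]
  · ext j; simp [Prod.snd_sum, Finset.sum_apply, Pi.single_apply]

lemma comp_conj_sum_du (hp : p.proj ∈ c.φ.source) (a : Fin m → ℂ) :
    c.comp p (Cx.conj (∑ γ, a γ • c.du γ p)) = 0 := by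
  simp only [map_sum, map_smul, Cx.conj_smul, c.comp_conj_du hp, smul_zero, Finset.sum_const_zero]

/-- On the coordinates `z` this is the structure equation of the anchor. On the coordinates `u` it
defines `R`: its term `C^ε_{αβ} N_ε^γ` compensates the vertical part of `C^ε_{αβ} δ_ε`. -/
lemma cbracket_delta_delta (hp : p.proj ∈ c.φ.source)
    (hN : ∀ α β, MDifferentiableAt (RModel n m) 𝓘(ℝ, ℂ) (N α β) p) (α β : Fin m) :
    cbracket (c.delta A N α) (c.delta A N β) p =
      ∑ γ, c.struct A α β γ p.proj • c.delta A N γ p + ∑ γ, c.R A N α β γ p • c.du γ p := by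
  have hα := c.cxMDiffAt_delta A N hp hN α
  have hβ := c.cxMDiffAt_delta A N hp hN β
  refine c.comp_ext hp ?_ ?_
  · rw [c.comp_cbracket hp hα hβ, c.cxDeriv_comp_delta A N hp hN, c.cxDeriv_comp_delta A N hp hN,
      map_add, c.comp_sum_du hp, map_sum]
    simp only [map_smul, c.comp_delta A N hp, c.cxDeriv_rho_delta A N hp]
    refine Prod.ext (funext fun k => ?_) (funext fun γ => ?_)
    · simp only [Prod.fst_sub, Prod.fst_add, Prod.fst_sum, Pi.sub_apply, Pi.add_apply,
        Finset.sum_apply, Prod.smul_fst, Pi.smul_apply, smul_eq_mul, Pi.zero_apply, add_zero]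
      exact (c.sum_struct_mul_rho A hp α β k).symm
    · simp only [Prod.snd_sub, Prod.snd_add, Prod.snd_sum, Pi.sub_apply, Pi.add_apply,
        Finset.sum_apply, Prod.smul_snd, Pi.smul_apply, smul_eq_mul, R, cderiv_eq_cxDeriv, mul_neg,
        Finset.sum_neg_distrib]
      ring
  · rw [c.comp_conj_cbracket hp hα hβ, c.cxDeriv_comp_conj_delta A N hp,
      c.cxDeriv_comp_conj_delta A N hp, map_add, map_add, c.comp_conj_sum_du hp]
    simp only [map_sum, Cx.conj_smul, map_smul, c.comp_conj_delta A N hp, smul_zero,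
      Finset.sum_const_zero, sub_zero, add_zero]

/-- Holomorphic coordinates detect only `δ_α`, their conjugates only `δ_β̄`. The derivatives of `ρ`
that arise vanish by holomorphy, leaving one derivative of `N` in each half. -/
lemma cbracket_delta_conj_delta (hp : p.proj ∈ c.φ.source)
    (hN : ∀ α β, MDifferentiableAt (RModel n m) 𝓘(ℝ, ℂ) (N α β) p) (α β : Fin m) :
    cbracket (c.delta A N α) (fun q => Cx.conj (c.delta A N β q)) p =
      ∑ γ, cderiv (Cx.conj (c.delta A N β p)) (N α γ) • c.du γ p -
        ∑ γ, cderiv (c.delta A N α p) (fun q => starRingEnd ℂ (N β γ q)) •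
          Cx.conj (c.du γ p) := by
  have hα := c.cxMDiffAt_delta A N hp hN α
  have hβ := c.cxMDiffAt_delta A N hp hN β
  simp only [cderiv_eq_cxDeriv, cxDeriv_star]
  refine c.comp_ext hp ?_ ?_
  · rw [c.comp_cbracket hp hα hβ.conj, c.cxDeriv_comp_delta A N hp hN,
      c.cxDeriv_comp_conj_delta A N hp, map_sub, c.comp_sum_du hp]
    simp only [map_sum, map_smul, c.comp_conj_du hp, smul_zero, Finset.sum_const_zero, sub_zero,
      zero_sub, c.cxDeriv_rho_conj_delta A N hp]
    refine Prod.ext (funext fun k => ?_) (funext fun γ => ?_) <;> simp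
  · rw [c.comp_conj_cbracket hp hα hβ.conj]
    simp only [Cx.conj_conj]
    rw [c.cxDeriv_comp_delta A N hp hN, c.cxDeriv_comp_conj_delta A N hp, map_sub, map_sub,
      c.comp_conj_sum_du hp]
    simp only [map_sum, Cx.conj_smul, Cx.conj_conj, Complex.conj_conj]
    rw [← map_sum, c.comp_sum_du hp]
    simp only [c.cxDeriv_rho_conj_delta A N hp]
    refine Prod.ext (funext fun k => ?_) (funext fun γ => ?_) <;> simp

lemma cbracket_delta_du (hp : p.proj ∈ c.φ.source)
    (hN : ∀ α β, MDifferentiableAt (RModel n m) 𝓘(ℝ, ℂ) (N α β) p) (α β : Fin m) :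
    cbracket (c.delta A N α) (c.du β) p = ∑ γ, cderiv (c.du β p) (N α γ) • c.du γ p := by
  have hα := c.cxMDiffAt_delta A N hp hN α
  have hβ := c.cxMDiffAt_du hp β
  simp only [cderiv_eq_cxDeriv]
  refine c.comp_ext hp ?_ ?_
  · rw [c.comp_cbracket hp hα hβ, c.cxDeriv_comp_delta A N hp hN, c.cxDeriv_comp_du hp,
      c.comp_sum_du hp]
    simp only [c.cxDeriv_rho_du A hp]
    refine Prod.ext (funext fun k => ?_) (funext fun γ => ?_) <;> simp
  · rw [c.comp_conj_cbracket hp hα hβ, c.cxDeriv_comp_conj_delta A N hp,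
      c.cxDeriv_comp_conj_du hp, c.comp_conj_sum_du hp, sub_zero]

lemma cbracket_delta_conj_du (hp : p.proj ∈ c.φ.source)
    (hN : ∀ α β, MDifferentiableAt (RModel n m) 𝓘(ℝ, ℂ) (N α β) p) (α β : Fin m) :
    cbracket (c.delta A N α) (fun q => Cx.conj (c.du β q)) p =
      ∑ γ, cderiv (Cx.conj (c.du β p)) (N α γ) • c.du γ p := by
  have hα := c.cxMDiffAt_delta A N hp hN α
  have hβ := c.cxMDiffAt_du hp β
  simp only [cderiv_eq_cxDeriv]
  refine c.comp_ext hp ?_ ?_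
  · rw [c.comp_cbracket hp hα hβ.conj, c.cxDeriv_comp_delta A N hp hN, c.cxDeriv_comp_conj_du hp,
      c.comp_sum_du hp]
    simp only [c.cxDeriv_rho_conj_du A hp]
    refine Prod.ext (funext fun k => ?_) (funext fun γ => ?_) <;> simp
  · rw [c.comp_conj_cbracket hp hα hβ.conj]
    simp only [Cx.conj_conj]
    rw [c.cxDeriv_comp_conj_delta A N hp, c.cxDeriv_comp_du hp, c.comp_conj_sum_du hp, sub_zero]

lemma cbracket_du_du (hp : p.proj ∈ c.φ.source) (α β : Fin m) :
    cbracket (c.du α) (c.du β) p = 0 := by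
  have hα := c.cxMDiffAt_du hp α
  have hβ := c.cxMDiffAt_du hp β
  refine c.comp_ext hp ?_ ?_
  · rw [c.comp_cbracket hp hα hβ, c.cxDeriv_comp_du hp, c.cxDeriv_comp_du hp]
    simp
  · rw [c.comp_conj_cbracket hp hα hβ, c.cxDeriv_comp_conj_du hp, c.cxDeriv_comp_conj_du hp]
    simp

lemma cbracket_du_conj_du (hp : p.proj ∈ c.φ.source) (α β : Fin m) :
    cbracket (c.du α) (fun q => Cx.conj (c.du β q)) p = 0 := by
  have hα := c.cxMDiffAt_du hp α
  have hβ := c.cxMDiffAt_du hp β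
  refine c.comp_ext hp ?_ ?_
  · rw [c.comp_cbracket hp hα hβ.conj, c.cxDeriv_comp_du hp, c.cxDeriv_comp_conj_du hp]
    simp
  · rw [c.comp_conj_cbracket hp hα hβ.conj]
    simp only [Cx.conj_conj]
    rw [c.cxDeriv_comp_conj_du hp, c.cxDeriv_comp_du hp]
    simp

/-! ### Brackets of the adapted frame -/

/-- Presents `𝒱_α` as lying over the zero section, so that the results for holomorphic sections of
`E` apply to it. -/
lemma V_fst (α : Fin m) (p : TotalSpace (Fin m → ℂ) E) :
    (c.V α p).1 = Cx.hol ((fun _ => 0 : ∀ x, E x) p.proj) := Cx.hol_zero.symm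

lemma prolongBracket_X_X (hp : p.proj ∈ c.φ.source)
    (hN : ∀ α β, MDifferentiableAt (RModel n m) 𝓘(ℝ, ℂ) (N α β) p) (α β : Fin m) :
    prolongBracket A (c.X A N α) (c.X A N β) p =
      ∑ γ, c.struct A α β γ p.proj • c.X A N γ p + ∑ γ, c.R A N α β γ p • c.V γ p := by
  refine Prod.ext ?_ ?_
  · rw [prolongBracket_fst_of_hol A c.φ.open_source (c.isHolSection_e α) (c.isHolSection_e β) hp
      (c.X_fst A N α) (c.X_fst A N β) (c.X_mem_prolongation A N hp α)
      (c.X_mem_prolongation A N hp β), c.bracket_e A hp, Cx.hol_sum]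
    simp only [Cx.hol_smul, Prod.fst_add, Prod.fst_sum, Prod.smul_fst, c.X_fst]
    simp [V]
  · simp only [Prod.snd_add, Prod.snd_sum, Prod.smul_snd, c.X_snd, prolongBracket]
    exact c.cbracket_delta_delta A N hp hN α β

lemma prolongBracket_X_Xbar (hp : p.proj ∈ c.φ.source)
    (hN : ∀ α β, MDifferentiableAt (RModel n m) 𝓘(ℝ, ℂ) (N α β) p) (α β : Fin m) :
    prolongBracket A (c.X A N α) (c.Xbar A N β) p =
      ∑ γ, cderiv (Cx.conj (c.delta A N β p)) (N α γ) • c.V γ p -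
        ∑ γ, cderiv (c.delta A N α p) (fun q => starRingEnd ℂ (N β γ q)) • c.Vbar γ p := by
  refine Prod.ext ?_ ?_
  · rw [prolongBracket_fst_of_hol_conj A c.φ.open_source (c.isHolSection_e α) (c.isHolSection_e β)
      hp (c.X_fst A N α) (fun q => by rw [Xbar, conjA, c.X_fst]) (c.X_mem_prolongation A N hp α)
      (conjA_mem_prolongation A (c.X_mem_prolongation A N hp β))]
    simp [V, Vbar, conjA, Prod.fst_sum]
  · simp only [Prod.snd_sub, Prod.snd_sum, Prod.smul_snd, c.X_snd, prolongBracket, Xbar, conjA]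
    exact c.cbracket_delta_conj_delta A N hp hN α β

lemma prolongBracket_X_V (hp : p.proj ∈ c.φ.source)
    (hN : ∀ α β, MDifferentiableAt (RModel n m) 𝓘(ℝ, ℂ) (N α β) p) (α β : Fin m) :
    prolongBracket A (c.X A N α) (c.V β) p = ∑ γ, cderiv (c.du β p) (N α γ) • c.V γ p := by
  refine Prod.ext ?_ ?_
  · rw [prolongBracket_fst_of_hol A c.φ.open_source (c.isHolSection_e α) IsHolSection.zero hp
      (c.X_fst A N α) (c.V_fst β) (c.X_mem_prolongation A N hp α) (c.V_mem_prolongation A hp β),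
      A.bracket_zero_right c.φ.open_source (c.isHolSection_e α) hp, Cx.hol_zero]
    simp [V, Prod.fst_sum]
  · simp only [Prod.snd_sum, Prod.smul_snd, c.X_snd, prolongBracket]
    exact c.cbracket_delta_du A N hp hN α β

lemma prolongBracket_X_Vbar (hp : p.proj ∈ c.φ.source)
    (hN : ∀ α β, MDifferentiableAt (RModel n m) 𝓘(ℝ, ℂ) (N α β) p) (α β : Fin m) :
    prolongBracket A (c.X A N α) (c.Vbar β) p =
      ∑ γ, cderiv (Cx.conj (c.du β p)) (N α γ) • c.V γ p := by
  refine Prod.ext ?_ ?_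
  · rw [prolongBracket_fst_of_hol_conj A c.φ.open_source (c.isHolSection_e α) IsHolSection.zero hp
      (c.X_fst A N α) (fun q => by rw [Vbar, conjA, c.V_fst]) (c.X_mem_prolongation A N hp α)
      (conjA_mem_prolongation A (c.V_mem_prolongation A hp β))]
    simp [V, Prod.fst_sum]
  · simp only [Prod.snd_sum, Prod.smul_snd, c.X_snd, prolongBracket]
    exact c.cbracket_delta_conj_du A N hp hN α β

lemma prolongBracket_V_V (hp : p.proj ∈ c.φ.source) (α β : Fin m) :
    prolongBracket A (c.V α) (c.V β) p = 0 := by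
  refine Prod.ext ?_ (c.cbracket_du_du hp α β)
  rw [prolongBracket_fst_of_hol A c.φ.open_source IsHolSection.zero IsHolSection.zero hp
    (c.V_fst α) (c.V_fst β) (c.V_mem_prolongation A hp α) (c.V_mem_prolongation A hp β),
    A.bracket_zero_right c.φ.open_source IsHolSection.zero hp, Cx.hol_zero]
  rfl

lemma prolongBracket_V_Vbar (hp : p.proj ∈ c.φ.source) (α β : Fin m) :
    prolongBracket A (c.V α) (c.Vbar β) p = 0 := by
  refine Prod.ext ?_ (c.cbracket_du_conj_du hp α β)
  rw [prolongBracket_fst_of_hol_conj A c.φ.open_source IsHolSection.zero IsHolSection.zero hp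
    (c.V_fst α) (fun q => by rw [Vbar, conjA, c.V_fst]) (c.V_mem_prolongation A hp α)
    (conjA_mem_prolongation A (c.V_mem_prolongation A hp β))]
  rfl

lemma cxMDiffAt_X_snd (hp : p.proj ∈ c.φ.source)
    (hN : ∀ α β, MDifferentiableAt (RModel n m) 𝓘(ℝ, ℂ) (N α β) p) (α : Fin m) :
    CxMDiffAt (I := RModel n m) (fun q => (c.X A N α q).2) p := by
  simp only [c.X_snd]
  exact c.cxMDiffAt_delta A N hp hN α

lemma cxMDiffAt_Vbar_snd (hp : p.proj ∈ c.φ.source) (α : Fin m) :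
    CxMDiffAt (I := RModel n m) (fun q => (c.Vbar α q).2) p :=
  (c.cxMDiffAt_du hp α).conj

lemma conjA_Vbar (α : Fin m) (p : TotalSpace (Fin m → ℂ) E) :
    conjA (c.Vbar α p) = c.V α p := by
  simp [Vbar, conjA]

lemma delta_eq_sum {N' : Fin n → Fin m → TotalSpace (Fin m → ℂ) E → ℂ} (α : Fin m)
    (h : ∀ β, N α β p = ∑ k, c.rho A α k p.proj * N' k β p) :
    c.delta A N α p = ∑ k, c.rho A α k p.proj • (c.dz k p - ∑ β, N' k β p • c.du β p) := by
  simp only [delta, h, smul_sub, Finset.sum_sub_distrib, Finset.smul_sum, Finset.sum_smul,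
    smul_smul]
  rw [Finset.sum_comm (f := fun β k => (c.rho A α k p.proj * N' k β p) • c.du β p)]

end BundleChart
end AdaptedFrame
end HolAlg

/-! ### The main theorem -/

theorem proposition1p2 {n m : ℕ} {M : Type*} [TopologicalSpace M] [ChartedSpace (Fin n → ℂ) M]
    [IsManifold 𝓘(ℂ, Fin n → ℂ) ω M]
    {E : M → Type*} [TopologicalSpace (TotalSpace (Fin m → ℂ) E)]
    [∀ x, AddCommGroup (E x)] [∀ x, Module ℂ (E x)] [∀ x, TopologicalSpace (E x)]
    [FiberBundle (Fin m → ℂ) E] [VectorBundle ℂ (Fin m → ℂ) E]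
    [ContMDiffVectorBundle ω (Fin m → ℂ) E 𝓘(ℂ, Fin n → ℂ)]
    (A : HolAlg.HolLieAlgebroid n m E) (c : HolAlg.BundleChart n m E)
    (W : Set (TotalSpace (Fin m → ℂ) E)) (hW : IsOpen W)
    (hWc : ∀ p ∈ W, p.proj ∈ c.φ.source)
    (N : Fin m → Fin m → TotalSpace (Fin m → ℂ) E → ℂ)
    (hN : ∀ α β, ContMDiffOn (HolAlg.RModel n m) 𝓘(ℝ, ℂ) ∞ (N α β) W) :
    -- the adapted frame consists of sections of the complexified prolongation
    (∀ p ∈ W, ∀ α,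
      c.X A N α p ∈ HolAlg.prolongation A p ∧ c.V α p ∈ HolAlg.prolongation A p ∧
      c.Xbar A N α p ∈ HolAlg.prolongation A p ∧ c.Vbar α p ∈ HolAlg.prolongation A p) ∧
    -- if `N` is induced by a nonlinear connection on `T'E`, then `δ_α = ρ^k_α δ_k`
    (∀ N' : Fin n → Fin m → TotalSpace (Fin m → ℂ) E → ℂ,
      (∀ p ∈ W, ∀ α β, N α β p = ∑ k, c.rho A α k p.proj * N' k β p) →
      ∀ p ∈ W, ∀ α, c.delta A N α p =
        ∑ k, c.rho A α k p.proj • (c.dz k p - ∑ β, N' k β p • c.du β p)) ∧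
    -- the brackets
    (∀ p ∈ W, ∀ α β,
      HolAlg.prolongBracket A (c.X A N α) (c.X A N β) p =
        ∑ γ, c.struct A α β γ p.proj • c.X A N γ p + ∑ γ, c.R A N α β γ p • c.V γ p ∧
      HolAlg.prolongBracket A (c.X A N α) (c.Xbar A N β) p =
        ∑ γ, HolAlg.cderiv (HolAlg.Cx.conj (c.delta A N β p)) (N α γ) • c.V γ p -
        ∑ γ, HolAlg.cderiv (c.delta A N α p) (fun q => starRingEnd ℂ (N β γ q)) • c.Vbar γ p ∧
      HolAlg.prolongBracket A (c.X A N α) (c.V β) p =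
        ∑ γ, HolAlg.cderiv (c.du β p) (N α γ) • c.V γ p ∧
      HolAlg.prolongBracket A (c.X A N α) (c.Vbar β) p =
        ∑ γ, HolAlg.cderiv (HolAlg.Cx.conj (c.du β p)) (N α γ) • c.V γ p ∧
      HolAlg.prolongBracket A (c.V α) (c.V β) p = 0 ∧
      HolAlg.prolongBracket A (c.V α) (c.Vbar β) p = 0 ∧
      -- and their conjugates
      HolAlg.prolongBracket A (c.Xbar A N α) (c.Xbar A N β) p =
        ∑ γ, starRingEnd ℂ (c.struct A α β γ p.proj) • c.Xbar A N γ p +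
        ∑ γ, starRingEnd ℂ (c.R A N α β γ p) • c.Vbar γ p ∧
      HolAlg.prolongBracket A (c.Xbar A N α) (c.Vbar β) p =
        ∑ γ, HolAlg.cderiv (HolAlg.Cx.conj (c.du β p)) (fun q => starRingEnd ℂ (N α γ q)) •
          c.Vbar γ p ∧
      HolAlg.prolongBracket A (c.Xbar A N α) (c.V β) p =
        ∑ γ, HolAlg.cderiv (c.du β p) (fun q => starRingEnd ℂ (N α γ q)) • c.Vbar γ p ∧
      HolAlg.prolongBracket A (c.Vbar α) (c.Vbar β) p = 0) := by
  have hNd : ∀ p ∈ W, ∀ α β, MDifferentiableAt (HolAlg.RModel n m) 𝓘(ℝ, ℂ) (N α β) p :=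
    fun p hp α β => ((hN α β).contMDiffAt (hW.mem_nhds hp)).mdifferentiableAt (by simp)
  refine ⟨fun p hp α => ?_, fun N' h p hp α => c.delta_eq_sum A N α (h p hp α),
    fun p hp α β => ?_⟩
  · have hX := c.X_mem_prolongation A N (hWc p hp) α
    have hV := c.V_mem_prolongation A (hWc p hp) α
    exact ⟨hX, hV, HolAlg.conjA_mem_prolongation A hX, HolAlg.conjA_mem_prolongation A hV⟩
  have hc := hWc p hp
  have hX := c.cxMDiffAt_X_snd A N hc (hNd p hp)
  have hV : ∀ α, HolAlg.CxMDiffAt (I := HolAlg.RModel n m) (fun q => (c.V α q).2) p :=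
    c.cxMDiffAt_du hc
  refine ⟨c.prolongBracket_X_X A N hc (hNd p hp) α β, c.prolongBracket_X_Xbar A N hc (hNd p hp) α β,
    c.prolongBracket_X_V A N hc (hNd p hp) α β, c.prolongBracket_X_Vbar A N hc (hNd p hp) α β,
    c.prolongBracket_V_V A hc α β, c.prolongBracket_V_Vbar A hc α β, ?_, ?_, ?_, ?_⟩
  · refine (HolAlg.prolongBracket_conjA A (hX α) (hX β)).trans ?_
    rw [c.prolongBracket_X_X A N hc (hNd p hp)]
    simp only [HolAlg.conjA_add, HolAlg.conjA_sum, HolAlg.conjA_smul]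
    rfl
  · refine (HolAlg.prolongBracket_conjA A (hX α) (hV β)).trans ?_
    rw [c.prolongBracket_X_V A N hc (hNd p hp)]
    simp only [HolAlg.conjA_sum, HolAlg.conjA_smul, HolAlg.cderiv_eq_cxDeriv, HolAlg.cxDeriv_star,
      HolAlg.Cx.conj_conj]
    rfl
  -- `𝒱_β` is the conjugate of `𝒱_β̄`, so this formula is the conjugate of the one for `[𝒳_α,
  -- 𝒱_β̄]`.
  · have := HolAlg.prolongBracket_conjA A (hX α) (c.cxMDiffAt_Vbar_snd hc β)
    simp only [c.conjA_Vbar] at this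
    refine this.trans ?_
    rw [c.prolongBracket_X_Vbar A N hc (hNd p hp)]
    simp only [HolAlg.conjA_sum, HolAlg.conjA_smul, HolAlg.cderiv_eq_cxDeriv, HolAlg.cxDeriv_star]
    rfl
  · refine (HolAlg.prolongBracket_conjA A (hV α) (hV β)).trans ?_
    rw [c.prolongBracket_V_V A hc]
    simp [HolAlg.conjA]
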